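/- **Setting.** Let $G=(V,E)$ be a finite strongly connected labelled directed graph (an automaton), $E\subseteq V\times V\times\{1,\dots,m\}$, where $(u,v,\sigma)\in E$ is an arc from $u$ to $v$ with label $\sigma$, and let $A_1,\dots,A_m\in\mathbb{R}^{n\times n}$. A tuple $(\sigma_1,\dots,\sigma_k)$ is *$G$-admissible* if it is the sequence of labels of a path of $G$; a sequence $\sigma_1,\sigma_2,\dots$ is *$G^T$-admissible* if $(\sigma_k,\dots,\sigma_1)$ is $G$-admissible for all $k\ge 1$. For a tuple $t=(\sigma_1,\dots,\sigma_k)$, or a path with these labels, put $A_t=A_{\sigma_k}\cdots A_{\sigma_1}$. The constrained joint spectral radius is $\rho(G,\mathcal{A})=\lim_{k\to\infty}\max\{\|A_t\|_2^{1/k} : t\ G\text{-admissible of length }k\}$. The adjacency matrix $A(G)$ has as $(u,v)$ entry the number of arcs from $u$ to $v$, and $\|\cdot\|_\infty$ is the largest absolute row sum. For $d\ge 1$ let $\mathbb{R}_{2d}[x]$ be the space of real homogeneous polynomials of degree $2d$ in $n$ variables, $\Sigma_{2d}$ its cone of sums of squares, and $\Sigma_{2d}^*$ the dual cone (the pseudo-measures).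 * $\rho_{SOS,2d}$ is the infimum of all $\gamma\ge 0$ for which there are strictly positive $p_v\in\Sigma_{2d}$ ($v\in V$) with $\sum_{v}\int_{\mathbb{S}^{n-1}}p_v=1$ and $\gamma^{2d}p_u(x)-p_v(A_\sigma x)\in\Sigma_{2d}$ for all $(u,v,\sigma)\in E$. * $(\mu,\gamma)$, with $\mu=(\mu_e)_{e\in E}$ and $\mu_e\in\Sigma_{2d}^*$, is *feasible for the dual program* if $\sum_{e\in E}\langle\mu_e,\|x\|_2^{2d}\rangle=1$ and, for every $v\in V$ and $p\in\Sigma_{2d}$, $$\sum_{(u,v,\sigma)\in E}\langle\mu_{uv\sigma},p(A_\sigma x)\rangle\ \ge\ \gamma^{2d}\sum_{(v,w,\sigma)\in E}\langle\mu_{vw\sigma},p\rangle .$$ **Algorithm with paths of length $l\ge1$.** Given a feasible $(\mu,\gamma)$, pick any $p_0\in\operatorname{int}(\Sigma_{2d})$ and any arc $(v_0,v_{-1},\sigma_0)\in E$ with $\langle\mu_{v_0v_{-1}\sigma_0},p_0\rangle>0$. For $k=0,l,2l,\dots$, pick any path $s$ maximizing $\langle\mu_{s[1]},p_k(A_sx)\rangle$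 among the paths of length $l$ of $G$ that end at $v_k$, where $s[1]$ is the first arc of $s$. Let $v_{k+l},\dots,v_{k+1},v_k$ be the successive nodes of $s$ and $\sigma_{k+l},\dots,\sigma_{k+1}$ its successive labels, and set $p_{k+l}(x)=p_k(A_sx)$. **Theorem.** Let $d,l\ge1$ and $\gamma<\rho_{SOS,2d}$. If $\gamma\ge 0$, there is a $\mu$ such that $(\mu,\gamma)$ is feasible for the dual program. For every $\mu$ such that $(\mu,\gamma)$ is feasible for the dual program, the algorithm has at least one infinite run, and every run, whatever choices are made, produces a $G^T$-admissible sequence of arcs $(v_1,v_0,\sigma_1),(v_2,v_1,\sigma_2),\dots$ of $E$ (so that $\sigma_1,\sigma_2,\dots$ is $G^T$-admissible) such that, with $s_k=(\sigma_k,\dots,\sigma_1)$, i.e. $A_{s_k}=A_{\sigma_1}\cdots A_{\sigma_k}$, $$\frac{\gamma}{\|(A(G)^T)^l\|_\infty^{1/(2dl)}}\ \le\ \liminf_{k\to\infty}\|A_{s_k}\|_2^{1/k}\qquad\text{and}\qquad \limsup_{k\to\infty}\|A_{s_k}\|_2^{1/k}\ \le\ \rho(G,\mathcal{A}).$$ In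 particular $\rho(G,\mathcal{A})\ge\gamma/\|(A(G)^T)^l\|_\infty^{1/(2dl)}$. -/

import Mathlib

open scoped Matrix

noncomputable section

namespace SwitchedSystem

/-! ### Automata, paths and products of matrices -/

/-- A finite automaton: a directed graph on `V` whose arcs `(u, v, σ)` carry labels `σ` in
`{1, …, m}`; parallel arcs with distinct labels are allowed. -/
structure Automaton (V : Type*) (m : ℕ) where
  arcs : Finset (V × V × Fin m)

variable {V : Type*} {m n d : ℕ}

/-- `G.IsPath u v s`: the list `s` of consecutive arcs is a path of `G` from `u` to `v`.
The length of the path is `s.length`, and its first arc is the head of the list. -/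
def Automaton.IsPath (G : Automaton V m) : V → V → List (V × V × Fin m) → Prop
  | u, v, [] => u = v
  | u, v, e :: s => e ∈ G.arcs ∧ e.1 = u ∧ G.IsPath e.2.1 v s

def Automaton.StronglyConnected (G : Automaton V m) : Prop :=
  ∀ u v : V, ∃ s, G.IsPath u v s

/-- The labels carried by a path, in order. -/
def labels (s : List (V × V × Fin m)) : List (Fin m) := s.map (fun e => e.2.2)

/-- `G.Admissible t`: the tuple of labels `t` is read along some path of `G`. -/
def Automaton.Admissible (G : Automaton V m) (t : List (Fin m)) : Prop :=
  ∃ u v s, G.IsPath u v s ∧ labels s = t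

/-- The automaton with all arcs reversed and the same labels. -/
def Automaton.transpose [DecidableEq V] (G : Automaton V m) : Automaton V m where
  arcs := G.arcs.image (fun e => (e.2.1, e.1, e.2.2))

/-- The adjacency matrix: the entry `(u, v)` is the number of arcs from `u` to `v`. -/
def Automaton.adjMatrix [DecidableEq V] (G : Automaton V m) : Matrix V V ℝ :=
  Matrix.of fun u v => ((Finset.univ.filter fun σ : Fin m => (u, v, σ) ∈ G.arcs).card : ℝ)

/-- The matrix norm induced by the Euclidean vector norm. -/
def euclNorm (M : Matrix (Fin n) (Fin n) ℝ) : ℝ := ‖Matrix.toEuclideanCLM (𝕜 := ℝ) M‖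

open scoped Matrix.Norms.Operator in
/-- The matrix norm induced by the infinity vector norm: the largest absolute row sum. -/
def inftyNorm {V : Type*} [Fintype V] (M : Matrix V V ℝ) : ℝ := ‖M‖

/-- `A_t = A_{σ_k} ⋯ A_{σ_1}` for `t = (σ_1, …, σ_k)`. -/
def prodMat (A : Fin m → Matrix (Fin n) (Fin n) ℝ) : List (Fin m) → Matrix (Fin n) (Fin n) ℝ
  | [] => 1
  | σ :: t => prodMat A t * A σ

/-- The largest value of `‖A_t‖ ^ (1 / k)` over the admissible tuples `t` of length `k`. -/
def growth (G : Automaton V m) (A : Fin m → Matrix (Fin n) (Fin n) ℝ) (k : ℕ) : ℝ :=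
  sSup {r : ℝ | ∃ t : List (Fin m), t.length = k ∧ G.Admissible t ∧
    r = euclNorm (prodMat A t) ^ (1 / (k : ℝ))}

/-- The constrained joint spectral radius, the limit of `growth G A k` as `k → ∞`
(this limit always exists, so that it equals the limit superior). -/
def cjsr (G : Automaton V m) (A : Fin m → Matrix (Fin n) (Fin n) ℝ) : ℝ :=
  Filter.limsup (growth G A) Filter.atTop

/-! ### Homogeneous polynomials, sums of squares, pseudo-measures -/

/-- The space of homogeneous real polynomials of degree `2 * d` in `n` variables. -/
abbrev HomPoly (n d : ℕ) : Type := MvPolynomial.homogeneousSubmodule (Fin n) ℝ (2 * d)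

/-- The linear change of variables `p(x) ↦ p(M x)`. -/
def subst (M : Matrix (Fin n) (Fin n) ℝ) : HomPoly n d →ₗ[ℝ] HomPoly n d :=
  (MvPolynomial.aeval (fun i : Fin n => ∑ j, MvPolynomial.C (M i j) * MvPolynomial.X j) :
    MvPolynomial (Fin n) ℝ →ₐ[ℝ] MvPolynomial (Fin n) ℝ).toLinearMap.restrict (by
      intro p hp
      rw [MvPolynomial.mem_homogeneousSubmodule] at hp ⊢
      have h := hp.aeval (S := ℝ)
        (fun i : Fin n => ∑ j, MvPolynomial.C (M i j) * MvPolynomial.X j) (n := 1) (by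
          intro i
          refine MvPolynomial.IsHomogeneous.sum _ _ _ (fun j _ => ?_)
          simpa using (MvPolynomial.isHomogeneous_C (Fin n) (M i j)).mul
            (MvPolynomial.isHomogeneous_X ℝ j))
      simpa using h)

/-- The polynomial `(x_1 ^ 2 + ⋯ + x_n ^ 2) ^ d`. -/
def normPow (n d : ℕ) : HomPoly n d :=
  ⟨(∑ i : Fin n, MvPolynomial.X i ^ 2) ^ d, by
    rw [MvPolynomial.mem_homogeneousSubmodule]
    exact (MvPolynomial.IsHomogeneous.sum _ _ _
      (fun i _ => MvPolynomial.isHomogeneous_X_pow i 2)).pow d⟩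

/-- The value of a homogeneous polynomial at a point. -/
def evalAt (x : EuclideanSpace ℝ (Fin n)) (p : HomPoly n d) : ℝ :=
  MvPolynomial.eval (fun i => x i) (p : MvPolynomial (Fin n) ℝ)

/-- The cone of homogeneous polynomials of degree `2 * d` that are sums of squares. -/
def sosCone (n d : ℕ) : Set (HomPoly n d) := {p | IsSumSq (p : MvPolynomial (Fin n) ℝ)}

/-- The usual topology of the finite-dimensional space of homogeneous polynomials:
convergence of all coefficients. -/
@[reducible] def coeffTopology (n d : ℕ) : TopologicalSpace (HomPoly n d) :=
  TopologicalSpace.induced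
    (fun p (α : Fin n →₀ ℕ) => MvPolynomial.coeff α (p : MvPolynomial (Fin n) ℝ)) inferInstance

/-- The interior of the cone of sums of squares. -/
def sosInterior (n d : ℕ) : Set (HomPoly n d) := @interior _ (coeffTopology n d) (sosCone n d)

/-- The dual cone of the cone of sums of squares; its elements are the pseudo-measures. -/
def sosDual (n d : ℕ) : Set (Module.Dual ℝ (HomPoly n d)) := {μ | ∀ p ∈ sosCone n d, 0 ≤ μ p}

/-- The push-forward of a functional by a matrix: `⟨M_# μ, p⟩ = ⟨μ, p(M x)⟩`. -/
def pushforward (M : Matrix (Fin n) (Fin n) ℝ) (μ : Module.Dual ℝ (HomPoly n d)) :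
    Module.Dual ℝ (HomPoly n d) := μ ∘ₗ subst M

/-! ### The primal and the dual sum of squares programs -/

/-- Feasibility of `(p, γ)` for the primal sum of squares program of degree `2 * d`. -/
structure PrimalFeasible [Fintype V] (G : Automaton V m) (A : Fin m → Matrix (Fin n) (Fin n) ℝ)
    (d : ℕ) (γ : ℝ) (p : V → HomPoly n d) : Prop where
  nonneg : 0 ≤ γ
  arc_sos : ∀ e ∈ G.arcs, γ ^ (2 * d) • p e.1 - subst (A e.2.2) (p e.2.1) ∈ sosCone n d
  node_sos : ∀ v, p v ∈ sosCone n d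
  pos : ∀ v, ∀ x : EuclideanSpace ℝ (Fin n), x ≠ 0 → 0 < evalAt x (p v)
  normalized : ∑ v, ∫ x : Metric.sphere (0 : EuclideanSpace ℝ (Fin n)) 1,
    evalAt (x : EuclideanSpace ℝ (Fin n)) (p v)
      ∂(MeasureTheory.volume : MeasureTheory.Measure (EuclideanSpace ℝ (Fin n))).toSphere = 1

/-- `ρ_{SOS,2d}(G, A)`: the optimal value of the primal program. -/
def jsrSos [Fintype V] (G : Automaton V m) (A : Fin m → Matrix (Fin n) (Fin n) ℝ) (d : ℕ) : ℝ :=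
  sInf {γ : ℝ | ∃ p : V → HomPoly n d, PrimalFeasible G A d γ p}

/-- Feasibility of `(μ, γ)` for the dual (moment) program of degree `2 * d`.
Only the values of `μ` on the arcs of `G` matter. -/
structure DualFeasible [DecidableEq V] (G : Automaton V m)
    (A : Fin m → Matrix (Fin n) (Fin n) ℝ) (d : ℕ) (γ : ℝ)
    (μ : V × V × Fin m → Module.Dual ℝ (HomPoly n d)) : Prop where
  flow : ∀ v : V,
    (∑ e ∈ G.arcs.filter (fun e => e.2.1 = v), pushforward (A e.2.2) (μ e)) -
      γ ^ (2 * d) • (∑ e ∈ G.arcs.filter (fun e => e.1 = v), μ e) ∈ sosDual n d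
  arc_dual : ∀ e ∈ G.arcs, μ e ∈ sosDual n d
  normalized : ∑ e ∈ G.arcs, μ e (normPow n d) = 1

/-! ### The algorithm -/

/-- The path `(v_{k+i}, v_{k+i-1}, σ_{k+i}), …, (v_{k+1}, v_k, σ_{k+1})` of length `i`
from `v_{k+i}` to `v_k`. -/
def backPath (v : ℕ → V) (σ : ℕ → Fin m) (k : ℕ) : ℕ → List (V × V × Fin m)
  | 0 => []
  | i + 1 => (v (k + i + 1), v (k + i), σ (k + i + 1)) :: backPath v σ k i

/-- `⟨μ_{s[1]}, p(A_s x)⟩` for a path `s` with first arc `s[1]`. -/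
def score (A : Fin m → Matrix (Fin n) (Fin n) ℝ)
    (μ : V × V × Fin m → Module.Dual ℝ (HomPoly n d)) (p : HomPoly n d) :
    List (V × V × Fin m) → ℝ
  | [] => 0
  | e :: s => μ e (subst (prodMat A (labels (e :: s))) p)

/-- The data produced by an infinite run of the algorithm: the nodes `v_0, v_1, …`, the node
`v_{-1}`, the labels `σ_0, σ_1, …`, and the polynomial `poly j` held at time `k = j * l`. -/
structure Run (V : Type*) (m n d : ℕ) where
  node : ℕ → V
  prev : V
  label : ℕ → Fin m
  poly : ℕ → HomPoly n d

/-- `r` is a possible run of the algorithm with incoming paths of length `l`, on the family of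
pseudo-measures `μ`. The initial polynomial is an arbitrary interior point of the cone of sums
of squares, the initial arc has positive pseudo-expectation, and at each time `k = j * l` an
arbitrary maximizer is picked among the paths of length `l` ending at `v_k`. -/
structure IsRun (G : Automaton V m) (A : Fin m → Matrix (Fin n) (Fin n) ℝ) (l : ℕ)
    (μ : V × V × Fin m → Module.Dual ℝ (HomPoly n d)) (r : Run V m n d) : Prop where
  init_poly : r.poly 0 ∈ sosInterior n d
  init_arc : (r.node 0, r.prev, r.label 0) ∈ G.arcs
  init_pos : 0 < μ (r.node 0, r.prev, r.label 0) (r.poly 0)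
  is_path : ∀ j : ℕ, G.IsPath (r.node (j * l + l)) (r.node (j * l))
    (backPath r.node r.label (j * l) l)
  is_max : ∀ j : ℕ, ∀ (u : V) (s : List (V × V × Fin m)), s.length = l →
    G.IsPath u (r.node (j * l)) s →
    score A μ (r.poly j) s ≤ score A μ (r.poly j) (backPath r.node r.label (j * l) l)
  poly_succ : ∀ j : ℕ, r.poly (j + 1) =
    subst (prodMat A (labels (backPath r.node r.label (j * l) l))) (r.poly j)

/-- The tuple `s_k = (σ_k, …, σ_1)`. -/
def revLabels (σ : ℕ → Fin m) : ℕ → List (Fin m)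
  | 0 => []
  | k + 1 => σ (k + 1) :: revLabels σ k

/-- The sequence `σ_1, σ_2, …` is admissible for the transposed automaton of `G`:
`(σ_k, …, σ_1)` is `G`-admissible for every `k ≥ 1`. -/
def Automaton.TransposeAdmissible (G : Automaton V m) (σ : ℕ → Fin m) : Prop :=
  ∀ k : ℕ, 1 ≤ k → G.Admissible (revLabels σ k)

/-- `‖A_{s_k}‖ ^ (1 / k)` for `s_k = (σ_k, …, σ_1)`, that is, `A_{s_k} = A_{σ_1} ⋯ A_{σ_k}`. -/
def rootNorm (A : Fin m → Matrix (Fin n) (Fin n) ℝ) (σ : ℕ → Fin m) (k : ℕ) : ℝ :=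
  euclNorm (prodMat A (revLabels σ k)) ^ (1 / (k : ℝ))

end SwitchedSystem

end

noncomputable section

namespace SwitchedSystem

variable {V : Type*} {m n d : ℕ}

/-! ### Sums of squares of polynomials -/

/-! The existence of `μ` is conic duality. If sums of squares `p_v` satisfied every arc constraint
with slack `‖x‖ ^ (2 * d)`, a small multiple of `‖x‖ ^ (2 * d)` could be added to each `p_v` without
losing the arc constraints, and `γ` would be at least the primal optimum. So for `γ` below the
optimum, `-arcUnit` lies outside the convex cone `primalCone` (`neg_arcUnit_notMem`). As `arcUnit`
is an order unit for this cone, the M. Riesz extension theorem gives a functional that is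
nonnegative on the cone and equals 1 on `arcUnit`; its components on the arcs are the
pseudo-measures (`exists_dualFeasible`).

The lower bound follows the quantity `D j`, the value at the current polynomial of the
pseudo-measure on the arc by which the run leaves `v_{jl}`. Iterating the flow inequality backwards
`l` times bounds `γ ^ (2 * d * l) * D j` by the sum of the scores of all paths of length `l` ending
at `v_{jl}` (`DualFeasible.flow_path_le`). Every score is at most the maximum, which is `D (j + 1)`,
and the number of paths is an entry of `(A(G)ᵀ) ^ l` applied to the all-ones vector, hence at most
`N`, the infinity norm of `(A(G)ᵀ) ^ l` (`IsRun.step_le`). So `D j` grows at least like `(γ ^ (2 * d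
* l) / N) ^ j`. Conversely `D j` is at most a constant times `‖A_{s_{jl}}‖ ^ (2 * d)`
(`DualFeasible.exists_apply_subst_le`), and roots are taken in `IsRun.le_liminf`. Pseudo-measures
are only known to be nonnegative on sums of squares, so every polynomial inequality used needs a sum
of squares certificate.

The upper bound is termwise: the labels of a run are admissible, so each root is one of those over
which `growth` takes the supremum. -/

theorem isSumSq_smul {p : MvPolynomial (Fin n) ℝ} (hp : IsSumSq p) {c : ℝ} (hc : 0 ≤ c) :
    IsSumSq (c • p) := by
  have h : IsSumSq (MvPolynomial.C c : MvPolynomial (Fin n) ℝ) := by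
    rw [← Real.mul_self_sqrt hc, MvPolynomial.C_mul]
    exact IsSumSq.mul_self _
  rw [MvPolynomial.smul_eq_C_mul]
  exact h.mul hp

theorem isSumSq_sq (p : MvPolynomial (Fin n) ℝ) : IsSumSq (p ^ 2) := by
  rw [sq]; exact IsSumSq.mul_self p

theorem isSumSq_pow {p : MvPolynomial (Fin n) ℝ} (hp : IsSumSq p) (k : ℕ) : IsSumSq (p ^ k) := by
  induction k with
  | zero => simp
  | succ k ih => rw [pow_succ]; exact ih.mul hp

/-- Induction on the telescoping identity `a^(k+1) - b^(k+1) = a (a^k - b^k) + (a - b) b^k`, whose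
factors are all sums of squares. -/
theorem isSumSq_pow_sub_pow {a b : MvPolynomial (Fin n) ℝ} (ha : IsSumSq a) (hb : IsSumSq b)
    (hab : IsSumSq (a - b)) (k : ℕ) : IsSumSq (a ^ k - b ^ k) := by
  induction k with
  | zero => simp
  | succ k ih =>
    have : a ^ (k + 1) - b ^ (k + 1) = a * (a ^ k - b ^ k) + (a - b) * b ^ k := by ring
    rw [this]
    exact (ha.mul ih).add (hab.mul (isSumSq_pow hb k))

/-- Every exponent of degree `a + b` splits into exponents of degrees `a` and `b`. -/
theorem exists_split_exponent (a b : ℕ) (α : Fin n →₀ ℕ) (h : α.degree = a + b) :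
    ∃ β δ : Fin n →₀ ℕ, α = β + δ ∧ β.degree = a ∧ δ.degree = b := by
  induction a generalizing α with
  | zero => exact ⟨0, α, by simp, by simp, by simpa using h⟩
  | succ a ih =>
    have hα : α ≠ 0 := by rintro rfl; simp at h; omega
    obtain ⟨i, hi⟩ := Finsupp.ne_iff.mp hα
    have hi' : Finsupp.single i 1 ≤ α := by
      rw [Finsupp.single_le_iff]; exact Nat.one_le_iff_ne_zero.mpr hi
    obtain ⟨α', rfl⟩ := exists_add_of_le hi'
    have h1 : α'.degree = a + b := by
      rw [map_add, Finsupp.degree_single] at h; omega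
    obtain ⟨β, δ, rfl, h2, h3⟩ := ih α' h1
    exact ⟨Finsupp.single i 1 + β, δ, by rw [add_assoc],
      by rw [map_add, Finsupp.degree_single, h2, add_comm], h3⟩

theorem isSumSq_sum_sq_sub_X_sq (i : Fin n) :
    IsSumSq ((∑ j : Fin n, MvPolynomial.X j ^ 2) - MvPolynomial.X i ^ 2 :
      MvPolynomial (Fin n) ℝ) := by
  rw [← Finset.add_sum_erase _ _ (Finset.mem_univ i), add_sub_cancel_left]
  exact IsSumSq.sum_sq _ _

/-- One variable is peeled off the monomial at a time; in degree one, `‖x‖² - x_i²` is the sum of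
the other squares. -/
theorem isSumSq_normPow_sub_monomial_sq (β : Fin n →₀ ℕ) (h : β.degree = d) :
    IsSumSq ((∑ i : Fin n, MvPolynomial.X i ^ 2) ^ d - MvPolynomial.monomial β 1 ^ 2 :
      MvPolynomial (Fin n) ℝ) := by
  induction d generalizing β with
  | zero =>
    obtain rfl : β = 0 := (Finsupp.degree_eq_zero_iff β).mp h
    simp [← MvPolynomial.C_apply]
  | succ d ih =>
    obtain ⟨β₁, δ, rfl, h1, h2⟩ := exists_split_exponent d 1 β h
    obtain ⟨i, rfl⟩ : ∃ i, δ = Finsupp.single i 1 := by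
      have hδ : δ ≠ 0 := by rintro rfl; simp at h2
      obtain ⟨i, hi⟩ := Finsupp.ne_iff.mp hδ
      have hi' : Finsupp.single i 1 ≤ δ := by
        rw [Finsupp.single_le_iff]; exact Nat.one_le_iff_ne_zero.mpr hi
      obtain ⟨α', rfl⟩ := exists_add_of_le hi'
      refine ⟨i, ?_⟩
      rw [map_add, Finsupp.degree_single] at h2
      rw [(Finsupp.degree_eq_zero_iff α').mp (by omega), add_zero]
    have h3 : (MvPolynomial.monomial (β₁ + Finsupp.single i 1) 1 : MvPolynomial (Fin n) ℝ) =
        MvPolynomial.monomial β₁ 1 * MvPolynomial.X i := by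
      rw [MvPolynomial.X, MvPolynomial.monomial_mul, one_mul]
    have h4 : ((∑ i : Fin n, MvPolynomial.X i ^ 2) ^ (d + 1) -
        (MvPolynomial.monomial β₁ 1 * MvPolynomial.X i) ^ 2 : MvPolynomial (Fin n) ℝ) =
        (∑ i : Fin n, MvPolynomial.X i ^ 2) *
          ((∑ i : Fin n, MvPolynomial.X i ^ 2) ^ d - MvPolynomial.monomial β₁ 1 ^ 2) +
        ((∑ j : Fin n, MvPolynomial.X j ^ 2) - MvPolynomial.X i ^ 2) *
          MvPolynomial.monomial β₁ 1 ^ 2 := by ring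
    rw [h3, h4]
    exact ((IsSumSq.sum_sq _ _).mul (ih β₁ h1)).add
      ((isSumSq_sum_sq_sub_X_sq i).mul (isSumSq_sq _))

/-- The arithmetic-geometric mean inequality: with `x^α = x^β x^δ` split into halves of degree `d`,
the square `|t| (x^β ∓ x^δ)²` bounds `2 t x^α` by `|t| (x^(2β) + x^(2δ))`, and each monomial square
is dominated by `‖x‖ ^ (2 * d)`. -/
theorem isSumSq_normPow_sub_monomial (α : Fin n →₀ ℕ) (h : α.degree = 2 * d) {c t : ℝ}
    (ht : |t| ≤ c) :
    IsSumSq (c • (∑ i : Fin n, MvPolynomial.X i ^ 2) ^ d - MvPolynomial.monomial α t :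
      MvPolynomial (Fin n) ℝ) := by
  obtain ⟨β, δ, rfl, h1, h2⟩ := exists_split_exponent d d α (by omega)
  set P : MvPolynomial (Fin n) ℝ := (∑ i : Fin n, MvPolynomial.X i ^ 2) ^ d with hP
  have key : c • P - MvPolynomial.monomial (β + δ) t =
      (c - |t|) • P + (|t| / 2) • (P - MvPolynomial.monomial β 1 ^ 2) +
      (|t| / 2) • (P - MvPolynomial.monomial δ 1 ^ 2) +
      (1 / 2 : ℝ) • (|t| • MvPolynomial.monomial β 1 ^ 2 + |t| • MvPolynomial.monomial δ 1 ^ 2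
        - (2 * t) • (MvPolynomial.monomial β 1 * MvPolynomial.monomial δ 1)) := by
    have : (MvPolynomial.monomial (β + δ) t : MvPolynomial (Fin n) ℝ) =
        t • (MvPolynomial.monomial β 1 * MvPolynomial.monomial δ 1) := by
      rw [MvPolynomial.monomial_mul, MvPolynomial.smul_monomial]; simp
    rw [this]
    module
  have hPs : IsSumSq P := isSumSq_pow (IsSumSq.sum_sq _ _) d
  rw [key]
  refine IsSumSq.add (IsSumSq.add (IsSumSq.add (isSumSq_smul hPs (by linarith)) ?_) ?_) ?_
  · exact isSumSq_smul (isSumSq_normPow_sub_monomial_sq β h1) (by positivity)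
  · exact isSumSq_smul (isSumSq_normPow_sub_monomial_sq δ h2) (by positivity)
  · refine isSumSq_smul ?_ (by norm_num)
    set a : MvPolynomial (Fin n) ℝ := MvPolynomial.monomial β 1
    set b : MvPolynomial (Fin n) ℝ := MvPolynomial.monomial δ 1
    rcases abs_cases t with ⟨h, -⟩ | ⟨h, -⟩
    · have : |t| • a ^ 2 + |t| • b ^ 2 - (2 * t) • (a * b) = |t| • (a - b) ^ 2 := by
        rw [h]; simp only [MvPolynomial.smul_eq_C_mul, MvPolynomial.C_mul, map_ofNat]; ring
      rw [this]
      exact isSumSq_smul (isSumSq_sq _) (abs_nonneg t)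
    · have : |t| • a ^ 2 + |t| • b ^ 2 - (2 * t) • (a * b) = |t| • (a + b) ^ 2 := by
        rw [h]
        simp only [MvPolynomial.smul_eq_C_mul, MvPolynomial.C_mul, map_ofNat, map_neg]; ring
      rw [this]
      exact isSumSq_smul (isSumSq_sq _) (abs_nonneg t)

/-! ### The cone of sums of squares -/

theorem sosCone_zero_mem : (0 : HomPoly n d) ∈ sosCone n d := by
  simp [sosCone]

theorem sosCone_add_mem {p q : HomPoly n d} (hp : p ∈ sosCone n d) (hq : q ∈ sosCone n d) :
    p + q ∈ sosCone n d := IsSumSq.add hp hq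

theorem sosCone_smul_mem {p : HomPoly n d} (hp : p ∈ sosCone n d) {c : ℝ} (hc : 0 ≤ c) :
    c • p ∈ sosCone n d := isSumSq_smul hp hc

theorem normPow_mem_sosCone : normPow n d ∈ sosCone n d :=
  isSumSq_pow (IsSumSq.sum_sq _ _) d

/-- A multiple of `‖x‖ ^ (2 * d)` dominates every polynomial of degree `2 * d`, as soon as the
factor is at least the sum of the absolute values of the coefficients. -/
theorem smul_normPow_sub_mem (q : HomPoly n d) {c : ℝ}
    (hc : ∑ α ∈ Finset.univ.finsuppAntidiag (2 * d),
      |MvPolynomial.coeff α (q : MvPolynomial (Fin n) ℝ)| ≤ c) :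
    c • normPow n d - q ∈ sosCone n d := by
  have hT : ∀ α : Fin n →₀ ℕ, α ∈ Finset.univ.finsuppAntidiag (2 * d) ↔ α.degree = 2 * d := by
    intro α
    simp [Finset.mem_finsuppAntidiag, Finsupp.degree_eq_sum]
  set T := (Finset.univ : Finset (Fin n)).finsuppAntidiag (2 * d) with hTdef
  have hq : (q : MvPolynomial (Fin n) ℝ) =
      ∑ α ∈ T, MvPolynomial.monomial α (MvPolynomial.coeff α (q : MvPolynomial (Fin n) ℝ)) := by
    conv_lhs => rw [MvPolynomial.as_sum (q : MvPolynomial (Fin n) ℝ)]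
    refine Finset.sum_subset (fun α hα => ?_) (fun α _ hα => ?_)
    · rw [hT]
      by_contra hne
      exact (MvPolynomial.mem_support_iff.mp hα)
        (((MvPolynomial.mem_homogeneousSubmodule _ _).mp q.2).coeff_eq_zero hne)
    · rw [MvPolynomial.notMem_support_iff.mp hα, map_zero]
  set P : MvPolynomial (Fin n) ℝ := (∑ i : Fin n, MvPolynomial.X i ^ 2) ^ d with hP
  set c₀ := ∑ α ∈ T, |MvPolynomial.coeff α (q : MvPolynomial (Fin n) ℝ)| with hc₀
  have h1 : IsSumSq (c₀ • P - (q : MvPolynomial (Fin n) ℝ)) := by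
    rw [hq, hc₀, Finset.sum_smul, ← Finset.sum_sub_distrib]
    exact IsSumSq.sum fun α hα => isSumSq_normPow_sub_monomial α ((hT α).mp hα) le_rfl
  have h2 : IsSumSq ((c - c₀) • P) :=
    isSumSq_smul (isSumSq_pow (IsSumSq.sum_sq _ _) d) (by linarith)
  have h3 : c • P - (q : MvPolynomial (Fin n) ℝ) =
      (c₀ • P - (q : MvPolynomial (Fin n) ℝ)) + (c - c₀) • P := by module
  change IsSumSq (c • P - (q : MvPolynomial (Fin n) ℝ))
  rw [h3]
  exact h1.add h2

theorem exists_smul_normPow_sub_mem (q : HomPoly n d) :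
    ∃ c : ℝ, 0 < c ∧ c • normPow n d - q ∈ sosCone n d :=
  ⟨_, add_pos_of_nonneg_of_pos (Finset.sum_nonneg fun _ _ => abs_nonneg _) one_pos,
    smul_normPow_sub_mem q (le_add_of_nonneg_right zero_le_one)⟩

/-- The neighbourhood is the unit ball of the `ℓ¹` distance between coefficients: there the
difference to `normPow` is dominated by `normPow` itself. -/
theorem normPow_mem_sosInterior : normPow n d ∈ sosInterior n d := by
  let _ := coeffTopology n d
  rw [sosInterior, mem_interior]
  refine ⟨{p | ∑ α ∈ Finset.univ.finsuppAntidiag (2 * d),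
      |MvPolynomial.coeff α ((normPow n d - p : HomPoly n d) : MvPolynomial (Fin n) ℝ)| < 1},
    fun p hp => ?_, ?_, by simp⟩
  · have := smul_normPow_sub_mem (normPow n d - p) (le_of_lt hp)
    rwa [one_smul, sub_sub_cancel] at this
  · have hcont : Continuous fun (p : HomPoly n d) (α : Fin n →₀ ℕ) =>
        MvPolynomial.coeff α (p : MvPolynomial (Fin n) ℝ) := continuous_induced_dom
    refine isOpen_lt ?_ continuous_const
    refine continuous_finsetSum _ fun α _ => ?_
    have : Continuous fun p : HomPoly n d =>
        MvPolynomial.coeff α (p : MvPolynomial (Fin n) ℝ) := (continuous_apply α).comp hcont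
    simp only [Submodule.coe_sub, MvPolynomial.coeff_sub]
    exact (continuous_const.sub this).abs

theorem sosInterior_subset : sosInterior n d ⊆ sosCone n d :=
  @interior_subset _ (coeffTopology n d) _

theorem evalAt_nonneg {p : HomPoly n d} (hp : p ∈ sosCone n d)
    (x : EuclideanSpace ℝ (Fin n)) : 0 ≤ evalAt x p := by
  have h : ∀ q : MvPolynomial (Fin n) ℝ, IsSumSq q →
      0 ≤ MvPolynomial.eval (fun i => x i) q := by
    intro q hq
    induction hq with
    | zero => simp
    | sq_add a _ ih => rw [map_add, map_mul]; exact add_nonneg (mul_self_nonneg _) ih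
  exact h _ hp

theorem evalAt_normPow (x : EuclideanSpace ℝ (Fin n)) :
    evalAt x (normPow n d) = ‖x‖ ^ (2 * d) := by
  simp [evalAt, normPow, pow_mul, EuclideanSpace.norm_sq_eq]

theorem subst_coe (M : Matrix (Fin n) (Fin n) ℝ) (p : HomPoly n d) :
    (subst M p : MvPolynomial (Fin n) ℝ) = MvPolynomial.aeval
      (fun i : Fin n => ∑ j, MvPolynomial.C (M i j) * MvPolynomial.X j)
      (p : MvPolynomial (Fin n) ℝ) := rfl

theorem subst_mem_sosCone (M : Matrix (Fin n) (Fin n) ℝ) {p : HomPoly n d}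
    (hp : p ∈ sosCone n d) : subst M p ∈ sosCone n d := by
  have h : ∀ q : MvPolynomial (Fin n) ℝ, IsSumSq q → IsSumSq (MvPolynomial.aeval
      (fun i : Fin n => (∑ j, MvPolynomial.C (M i j) * MvPolynomial.X j :
        MvPolynomial (Fin n) ℝ)) q) := by
    intro q hq
    induction hq with
    | zero => simp
    | sq_add a _ ih => rw [map_add, map_mul]; exact IsSumSq.sq_add _ ih
  exact h _ hp

theorem subst_one (p : HomPoly n d) : subst 1 p = p := by
  apply Subtype.ext
  rw [subst_coe]
  simp [Matrix.one_apply]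

theorem subst_subst (M N : Matrix (Fin n) (Fin n) ℝ) (p : HomPoly n d) :
    subst M (subst N p) = subst (N * M) p := by
  apply Subtype.ext
  rw [subst_coe, subst_coe, subst_coe, ← AlgHom.comp_apply]
  congr 1
  ext1 i
  simp only [AlgHom.comp_apply, MvPolynomial.aeval_X, map_sum, map_mul, Matrix.mul_apply,
    Finset.sum_mul, Finset.mul_sum]
  rw [Finset.sum_comm]
  refine Finset.sum_congr rfl fun j _ => Finset.sum_congr rfl fun k _ => ?_
  rw [← MvPolynomial.algebraMap_eq, AlgHom.commutes, mul_assoc]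

/-- Cauchy–Schwarz against the all-ones vector, certified by Lagrange's identity `n ∑ y_j² - (∑
y_j)² = ½ ∑∑ (y_i - y_j)²` with `y_j = a_j x_j`. -/
theorem isSumSq_cauchy (a : Fin n → ℝ) {K : ℝ} (ha : ∀ j, a j ^ 2 ≤ K) :
    IsSumSq (((n : ℝ) * K) • (∑ j, MvPolynomial.X j ^ 2) -
      (∑ j, MvPolynomial.C (a j) * MvPolynomial.X j) ^ 2 : MvPolynomial (Fin n) ℝ) := by
  set y : Fin n → MvPolynomial (Fin n) ℝ := fun j => MvPolynomial.C (a j) * MvPolynomial.X j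
  have h1 : ((n : ℝ) * K) • (∑ j, MvPolynomial.X j ^ 2) - (∑ j, y j) ^ 2 =
      ∑ j, ((n : ℝ) * (K - a j ^ 2)) • (MvPolynomial.X j ^ 2 : MvPolynomial (Fin n) ℝ) +
      (1 / 2 : ℝ) • ∑ i, ∑ j, (y i - y j) ^ 2 := by
    have e1 : ∑ i, ∑ j, (y i - y j) ^ 2 =
        (2 : ℝ) • ((n : ℝ) • ∑ j, y j ^ 2 - (∑ j, y j) ^ 2) := by
      have : ∀ i j, (y i - y j) ^ 2 = y i ^ 2 + y j ^ 2 - 2 * (y i * y j) := fun i j => by ring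
      simp only [this, Finset.sum_add_distrib, Finset.sum_sub_distrib, Finset.sum_const,
        Finset.card_univ, Fintype.card_fin, ← Finset.mul_sum, ← Finset.sum_mul,
        ← Finset.smul_sum]
      rw [MvPolynomial.smul_eq_C_mul, MvPolynomial.smul_eq_C_mul]
      simp only [map_ofNat, map_natCast, nsmul_eq_mul]
      ring
    have e2 : ∑ j, y j ^ 2 = ∑ j, (a j ^ 2) • (MvPolynomial.X j ^ 2) := by
      refine Finset.sum_congr rfl fun j _ => ?_
      rw [MvPolynomial.smul_eq_C_mul, map_pow, mul_pow]
    rw [e1, e2, smul_smul, Finset.smul_sum, Finset.smul_sum]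
    have e3 : ∑ j, ((n : ℝ) * (K - a j ^ 2)) • (MvPolynomial.X j ^ 2 : MvPolynomial (Fin n) ℝ) =
        ∑ j, ((n : ℝ) * K) • (MvPolynomial.X j ^ 2 : MvPolynomial (Fin n) ℝ) -
        ∑ j, (n : ℝ) • (a j ^ 2) • (MvPolynomial.X j ^ 2 : MvPolynomial (Fin n) ℝ) := by
      rw [← Finset.sum_sub_distrib]
      exact Finset.sum_congr rfl fun j _ => by module
    rw [e3]
    module
  rw [h1]
  refine IsSumSq.add (IsSumSq.sum fun j _ => isSumSq_smul (isSumSq_sq _) ?_)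
    (isSumSq_smul (IsSumSq.sum fun i _ => IsSumSq.sum_sq _ _) (by norm_num))
  exact mul_nonneg (Nat.cast_nonneg n) (sub_nonneg.mpr (ha j))

theorem abs_entry_le_euclNorm (M : Matrix (Fin n) (Fin n) ℝ) (i j : Fin n) :
    |M i j| ≤ euclNorm M := by
  have h1 := (Matrix.toEuclideanCLM (𝕜 := ℝ) M).le_opNorm (EuclideanSpace.single j 1)
  have h2 := PiLp.norm_apply_le (Matrix.toEuclideanCLM (𝕜 := ℝ) M (EuclideanSpace.single j 1)) i
  have h3 : (Matrix.toEuclideanCLM (𝕜 := ℝ) M (EuclideanSpace.single j 1)) i = M i j := by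
    simp [Matrix.ofLp_toEuclideanCLM]
  rw [h3, Real.norm_eq_abs] at h2
  simp only [PiLp.norm_single, norm_one, mul_one] at h1
  exact h2.trans h1

/-- `(n ‖M‖) ^ (2 * d) ‖x‖ ^ (2 * d) - ‖M x‖ ^ (2 * d)` is a sum of squares. -/
theorem smul_normPow_sub_subst_mem (M : Matrix (Fin n) (Fin n) ℝ) :
    ((n * euclNorm M) ^ (2 * d)) • normPow n d - subst M (normPow n d) ∈ sosCone n d := by
  change IsSumSq (((n * euclNorm M) ^ (2 * d)) • (∑ i : Fin n, MvPolynomial.X i ^ 2) ^ d -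
    MvPolynomial.aeval (fun i : Fin n => (∑ j, MvPolynomial.C (M i j) * MvPolynomial.X j :
      MvPolynomial (Fin n) ℝ)) ((∑ i : Fin n, MvPolynomial.X i ^ 2) ^ d))
  rw [map_pow, map_sum, pow_mul, ← smul_pow]
  simp only [map_pow, MvPolynomial.aeval_X]
  refine isSumSq_pow_sub_pow (isSumSq_smul (IsSumSq.sum_sq _ _) (sq_nonneg _))
    (IsSumSq.sum_sq _ _) ?_ d
  -- One factor `n` pays for the number of rows of `M`, the other for Cauchy–Schwarz within each
  -- row.
  have h : ((n * euclNorm M) ^ 2) • (∑ i : Fin n, MvPolynomial.X i ^ 2 :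
      MvPolynomial (Fin n) ℝ) =
      ∑ _i : Fin n, ((n : ℝ) * euclNorm M ^ 2) • (∑ i : Fin n, MvPolynomial.X i ^ 2) := by
    rw [Finset.sum_const, Finset.card_univ, Fintype.card_fin, ← Nat.cast_smul_eq_nsmul ℝ,
      smul_smul]
    congr 1
    ring
  rw [h, ← Finset.sum_sub_distrib]
  refine IsSumSq.sum fun i _ => isSumSq_cauchy _ fun j => ?_
  rw [← sq_abs]
  exact pow_le_pow_left₀ (abs_nonneg _) (abs_entry_le_euclNorm M i j) 2

/-! ### Pseudo-measures -/

theorem sosDual_le {μ : Module.Dual ℝ (HomPoly n d)} (hμ : μ ∈ sosDual n d) {p q : HomPoly n d}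
    (h : q - p ∈ sosCone n d) : μ p ≤ μ q := by
  have := hμ _ h
  rw [map_sub] at this
  linarith

/-! ### The primal program -/

theorem evalAt_smul (c : ℝ) (p : HomPoly n d) (x : EuclideanSpace ℝ (Fin n)) :
    evalAt x (c • p) = c * evalAt x p := by
  simp [evalAt]

theorem evalAt_sub (p q : HomPoly n d) (x : EuclideanSpace ℝ (Fin n)) :
    evalAt x (p - q) = evalAt x p - evalAt x q := by
  simp [evalAt]

theorem continuous_evalAt (p : HomPoly n d) :
    Continuous fun x : EuclideanSpace ℝ (Fin n) => evalAt x p := by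
  unfold evalAt
  exact (MvPolynomial.continuous_eval (p : MvPolynomial (Fin n) ℝ)).comp (by fun_prop)

theorem smul_norm_pow_le_evalAt {p : HomPoly n d} {ε : ℝ}
    (h : p - ε • normPow n d ∈ sosCone n d) (x : EuclideanSpace ℝ (Fin n)) :
    ε * ‖x‖ ^ (2 * d) ≤ evalAt x p := by
  have := evalAt_nonneg h x
  rw [evalAt_sub, evalAt_smul, evalAt_normPow] at this
  linarith

theorem integral_sphere_evalAt_pos [NeZero n] {p : HomPoly n d} {ε : ℝ} (hε : 0 < ε)
    (h : p - ε • normPow n d ∈ sosCone n d) :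
    0 < ∫ x : Metric.sphere (0 : EuclideanSpace ℝ (Fin n)) 1,
      evalAt (x : EuclideanSpace ℝ (Fin n)) p
        ∂(MeasureTheory.volume : MeasureTheory.Measure (EuclideanSpace ℝ (Fin n))).toSphere := by
  set ν := (MeasureTheory.volume : MeasureTheory.Measure (EuclideanSpace ℝ (Fin n))).toSphere
  have : Nontrivial (EuclideanSpace ℝ (Fin n)) :=
    Module.nontrivial_of_finrank_pos (R := ℝ) (by
      rw [finrank_euclideanSpace_fin]; exact Nat.pos_of_ne_zero (NeZero.ne n))
  have hν : ν ≠ 0 := MeasureTheory.Measure.toSphere_ne_zero _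
  have hc : Continuous fun x : Metric.sphere (0 : EuclideanSpace ℝ (Fin n)) 1 =>
      evalAt (x : EuclideanSpace ℝ (Fin n)) p := (continuous_evalAt p).comp continuous_subtype_val
  have hi : MeasureTheory.Integrable (fun x : Metric.sphere (0 : EuclideanSpace ℝ (Fin n)) 1 =>
      evalAt (x : EuclideanSpace ℝ (Fin n)) p) ν :=
    hc.integrable_of_hasCompactSupport (HasCompactSupport.of_compactSpace _)
  have hle : ∀ x : Metric.sphere (0 : EuclideanSpace ℝ (Fin n)) 1,
      ε ≤ evalAt (x : EuclideanSpace ℝ (Fin n)) p := fun x => by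
    have := smul_norm_pow_le_evalAt h (x : EuclideanSpace ℝ (Fin n))
    rwa [norm_eq_of_mem_sphere, one_pow, mul_one] at this
  calc (0 : ℝ) < ν.real Set.univ * ε := mul_pos (by
          rw [MeasureTheory.measureReal_def]
          exact ENNReal.toReal_pos (MeasureTheory.Measure.measure_univ_ne_zero.mpr hν)
            (MeasureTheory.measure_ne_top _ _)) hε
    _ = ∫ _x, ε ∂ν := by rw [MeasureTheory.integral_const, smul_eq_mul]
    _ ≤ _ := MeasureTheory.integral_mono (MeasureTheory.integrable_const _) hi hle

/-- Strictly positive solutions of the arc constraints bound the optimal value of the primal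
program from above; the normalization can be dropped. -/
theorem jsrSos_le [Fintype V] (G : Automaton V m) (A : Fin m → Matrix (Fin n) (Fin n) ℝ)
    {γ : ℝ} (hγ : 0 ≤ γ) (p : V → HomPoly n d) {ε : ℝ} (hε : 0 < ε)
    (hp : ∀ v, p v - ε • normPow n d ∈ sosCone n d)
    (harc : ∀ e ∈ G.arcs, γ ^ (2 * d) • p e.1 - subst (A e.2.2) (p e.2.1) ∈ sosCone n d) :
    jsrSos G A d ≤ γ := by
  rcases isEmpty_or_nonempty V with hV | hV
  -- Without nodes, and likewise for `n = 0` where the sphere is empty, the normalization reads `0 =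
  -- 1`; the infimum of the empty set is `0` by convention.
  · have : {γ : ℝ | ∃ p : V → HomPoly n d, PrimalFeasible G A d γ p} = ∅ := by
      ext γ'
      simp only [Set.mem_ofPred_eq, Set.mem_empty_iff_false, iff_false, not_exists]
      exact fun q hq => by simpa using hq.normalized
    rw [jsrSos, this, Real.sInf_empty]
    exact hγ
  rcases Nat.eq_zero_or_pos n with rfl | hn
  · have : {γ : ℝ | ∃ p : V → HomPoly 0 d, PrimalFeasible G A d γ p} = ∅ := by
      ext γ'
      simp only [Set.mem_ofPred_eq, Set.mem_empty_iff_false, iff_false, not_exists]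
      intro q hq
      have h := hq.normalized
      have : IsEmpty (Metric.sphere (0 : EuclideanSpace ℝ (Fin 0)) 1) := by
        refine ⟨fun x => ?_⟩
        have := norm_eq_of_mem_sphere x
        rw [Subsingleton.elim (x : EuclideanSpace ℝ (Fin 0)) 0, norm_zero] at this
        exact zero_ne_one this
      rw [MeasureTheory.Measure.eq_zero_of_isEmpty (MeasureTheory.Measure.toSphere _)] at h
      simp only [MeasureTheory.integral_zero_measure, Finset.sum_const_zero] at h
      exact zero_ne_one h
    rw [jsrSos, this, Real.sInf_empty]
    exact hγ
  · have : NeZero n := ⟨hn.ne'⟩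
    set I : ℝ := ∑ v, ∫ x : Metric.sphere (0 : EuclideanSpace ℝ (Fin n)) 1,
      evalAt (x : EuclideanSpace ℝ (Fin n)) (p v)
        ∂(MeasureTheory.volume : MeasureTheory.Measure (EuclideanSpace ℝ (Fin n))).toSphere
      with hI
    have hIpos : 0 < I :=
      Finset.sum_pos (fun v _ => integral_sphere_evalAt_pos hε (hp v)) Finset.univ_nonempty
    refine csInf_le ⟨0, fun γ' ⟨q, hq⟩ => hq.nonneg⟩ ⟨fun v => I⁻¹ • p v, hγ, ?_, ?_, ?_, ?_⟩
    · intro e he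
      have := sosCone_smul_mem (harc e he) (inv_nonneg.mpr hIpos.le)
      rwa [smul_sub, smul_comm, ← map_smul] at this
    · intro v
      refine sosCone_smul_mem ?_ (inv_nonneg.mpr hIpos.le)
      simpa using sosCone_add_mem (hp v) (sosCone_smul_mem normPow_mem_sosCone hε.le)
    · intro v x hx
      rw [evalAt_smul]
      exact mul_pos (inv_pos.mpr hIpos) ((mul_pos hε (pow_pos (norm_pos_iff.mpr hx) _)).trans_le
        (smul_norm_pow_le_evalAt (hp v) x))
    · simp only [evalAt_smul, MeasureTheory.integral_const_mul, ← Finset.mul_sum]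
      exact inv_mul_cancel₀ hIpos.ne'

/-! ### Duality -/

/-- The families `y` of polynomials, indexed by the arcs, such that `y` plus the left-hand sides
of the arc constraints of the primal program is a family of sums of squares, for some family of
sums of squares indexed by the nodes. -/
def primalCone (G : Automaton V m) (A : Fin m → Matrix (Fin n) (Fin n) ℝ) (d : ℕ) (γ : ℝ) :
    PointedCone ℝ (V × V × Fin m → HomPoly n d) where
  carrier := {y | ∃ p : V → HomPoly n d, (∀ v, p v ∈ sosCone n d) ∧
    ∀ e ∈ G.arcs, y e + (γ ^ (2 * d) • p e.1 - subst (A e.2.2) (p e.2.1)) ∈ sosCone n d}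
  add_mem' := by
    rintro y z ⟨p, hp, hy⟩ ⟨q, hq, hz⟩
    refine ⟨p + q, fun v => sosCone_add_mem (hp v) (hq v), fun e he => ?_⟩
    have := sosCone_add_mem (hy e he) (hz e he)
    convert this using 1
    simp only [Pi.add_apply, map_add, smul_add]
    abel
  zero_mem' := ⟨0, fun v => sosCone_zero_mem, fun e _ => by simpa using sosCone_zero_mem⟩
  smul_mem' := by
    rintro ⟨c, hc⟩ y ⟨p, hp, hy⟩
    refine ⟨c • p, fun v => sosCone_smul_mem (hp v) hc, fun e he => ?_⟩
    have := sosCone_smul_mem (hy e he) hc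
    convert this using 1
    simp only [Pi.smul_apply, map_smul, smul_add, smul_sub, Nonneg.mk_smul]
    rw [smul_comm c (γ ^ (2 * d))]

theorem mem_primalCone {G : Automaton V m} {A : Fin m → Matrix (Fin n) (Fin n) ℝ} {γ : ℝ}
    {y : V × V × Fin m → HomPoly n d} : y ∈ primalCone G A d γ ↔
    ∃ p : V → HomPoly n d, (∀ v, p v ∈ sosCone n d) ∧
    ∀ e ∈ G.arcs, y e + (γ ^ (2 * d) • p e.1 - subst (A e.2.2) (p e.2.1)) ∈ sosCone n d :=
  Iff.rfl

/-- The family equal to `‖x‖ ^ (2 * d)` on the arcs and to `0` elsewhere. -/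
def arcUnit [DecidableEq V] (G : Automaton V m) (n d : ℕ) : V × V × Fin m → HomPoly n d :=
  ∑ e ∈ G.arcs, Pi.single e (normPow n d)

theorem arcUnit_apply [DecidableEq V] (G : Automaton V m) {e : V × V × Fin m} (he : e ∈ G.arcs) :
    arcUnit G n d e = normPow n d := by
  rw [arcUnit, Finset.sum_apply, Finset.sum_eq_single e, Pi.single_eq_same]
  · intro f _ hf; rw [Pi.single_eq_of_ne hf.symm]
  · exact fun h => absurd he h

/-- A common factor for finitely many polynomials in `exists_smul_normPow_sub_mem`. -/
theorem exists_uniform_smul_normPow_sub_mem {ι : Type*} (s : Finset ι) (q : ι → HomPoly n d) :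
    ∃ c : ℝ, 0 < c ∧ ∀ i ∈ s, c • normPow n d - q i ∈ sosCone n d := by
  choose c hc hcq using fun i => exists_smul_normPow_sub_mem (q i)
  refine ⟨1 + ∑ i ∈ s, c i,
    add_pos_of_pos_of_nonneg one_pos (Finset.sum_nonneg fun i _ => (hc i).le), fun i hi => ?_⟩
  have h1 : c i ≤ ∑ i ∈ s, c i := Finset.single_le_sum (fun i _ => (hc i).le) hi
  have h2 := sosCone_add_mem (hcq i)
    (sosCone_smul_mem normPow_mem_sosCone (c := 1 + ∑ i ∈ s, c i - c i) (by linarith))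
  convert h2 using 1
  module

/-- The slack `‖x‖ ^ (2 * d)` on every arc absorbs `c⁻¹ ‖A_σ x‖ ^ (2 * d)`, so `p_v + c⁻¹ ‖x‖ ^ (2 *
d)` is a strictly positive solution for `γ`. -/
theorem neg_arcUnit_notMem [Fintype V] [DecidableEq V] (G : Automaton V m)
    (A : Fin m → Matrix (Fin n) (Fin n) ℝ) {γ : ℝ} (hγ0 : 0 ≤ γ) (hγ : γ < jsrSos G A d) :
    -arcUnit G n d ∉ primalCone G A d γ := by
  rintro ⟨p, hp, h⟩
  obtain ⟨c, hc, hcq⟩ := exists_uniform_smul_normPow_sub_mem G.arcs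
    fun e => subst (A e.2.2) (normPow n d)
  refine absurd hγ (not_lt.mpr (jsrSos_le G A hγ0 (fun v => p v + c⁻¹ • normPow n d)
    (inv_pos.mpr hc) (fun v => by simpa using hp v) fun e he => ?_))
  have h1 := h e he
  rw [Pi.neg_apply, arcUnit_apply G he] at h1
  have h2 := sosCone_smul_mem (hcq e he) (inv_pos.mpr hc).le
  rw [smul_sub, smul_smul, inv_mul_cancel₀ hc.ne', one_smul] at h2
  have h3 : (γ ^ (2 * d) * c⁻¹) • normPow n d ∈ sosCone n d :=
    sosCone_smul_mem normPow_mem_sosCone (by positivity)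
  convert sosCone_add_mem (sosCone_add_mem h1 h2) h3 using 1
  rw [map_add, map_smul]
  module

/-- Since an order unit is available, the functional on the line through `arcUnit` extends
algebraically, and `primalCone` need not be shown closed. -/
theorem exists_dualFeasible [Fintype V] [DecidableEq V] (G : Automaton V m)
    (A : Fin m → Matrix (Fin n) (Fin n) ℝ) {γ : ℝ} (hγ0 : 0 ≤ γ) (hγ : γ < jsrSos G A d) :
    ∃ μ, DualFeasible G A d γ μ := by
  have hneg := neg_arcUnit_notMem G A hγ0 hγ
  set C := primalCone G A d γ with hC
  have hne : arcUnit G n d ≠ 0 := by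
    intro h0
    rw [h0, neg_zero] at hneg
    exact hneg C.zero_mem
  obtain ⟨g, hg1, hg⟩ := riesz_extension C
    (LinearPMap.mkSpanSingleton (arcUnit G n d) (1 : ℝ) hne) (by
      rintro ⟨x, hx⟩ hxC
      obtain ⟨c, rfl⟩ := Submodule.mem_span_singleton.mp hx
      have : (LinearPMap.mkSpanSingleton (arcUnit G n d) (1 : ℝ) hne)
          ⟨c • arcUnit G n d, hx⟩ = c :=
        (LinearPMap.mkSpanSingleton'_apply _ _ _ c hx).trans (by simp)
      rw [this]
      by_contra hc
      push Not at hc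
      apply hneg
      have h1 := C.smul_mem (inv_nonneg.mpr (by linarith : 0 ≤ -c)) hxC
      have h2 : (-c)⁻¹ • c • arcUnit G n d = -arcUnit G n d := by
        rw [smul_smul, inv_neg, neg_mul, inv_mul_cancel₀ hc.ne]
        funext e
        rw [Pi.smul_apply, neg_one_smul, Pi.neg_apply]
      rw [← h2]
      exact h1) (by
      intro y
      -- The order unit property: some multiple of `arcUnit` added to `y` lands in the cone, with
      -- all node polynomials zero.
      obtain ⟨c, hc, hcq⟩ := exists_uniform_smul_normPow_sub_mem G.arcs fun e => -y e
      refine ⟨⟨c • arcUnit G n d, Submodule.mem_span_singleton.mpr ⟨c, rfl⟩⟩,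
        mem_primalCone.mpr ⟨0, fun v => sosCone_zero_mem, fun e he => ?_⟩⟩
      have := hcq e he
      simpa [arcUnit_apply G he] using this)
  have hunit : g (arcUnit G n d) = 1 := by
    rw [← LinearPMap.mkSpanSingleton_apply ℝ ℝ hne (1 : ℝ) (σ := RingHom.id ℝ)]
    exact hg1 ⟨arcUnit G n d, Submodule.mem_span_singleton_self _⟩
  refine ⟨fun e => g ∘ₗ LinearMap.single ℝ (fun _ => HomPoly n d) e, ?_, ?_, ?_⟩
  · intro v q hq
    have hy : (∑ e ∈ G.arcs.filter (fun e => e.2.1 = v), Pi.single e (subst (A e.2.2) q)) -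
        γ ^ (2 * d) • (∑ e ∈ G.arcs.filter (fun e => e.1 = v), Pi.single e q) ∈ C := by
      -- With `q` at the node `v` and `0` elsewhere, the family tested here cancels the primal
      -- expression exactly on every arc.
      refine mem_primalCone.mpr ⟨Pi.single v q, fun w => ?_, fun e he => ?_⟩
      · rcases eq_or_ne w v with rfl | hw
        · rwa [Pi.single_eq_same]
        · rw [Pi.single_eq_of_ne hw]; exact sosCone_zero_mem
      · have h1 : ∀ (P : V × V × Fin m → Prop) [DecidablePred P]
            (f : V × V × Fin m → HomPoly n d),
            (∑ a ∈ G.arcs.filter P, (Pi.single a (f a) : V × V × Fin m → HomPoly n d)) e =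
              if P e then f e else 0 := by
          intro P _ f
          rw [Finset.sum_apply, Finset.sum_filter, Finset.sum_eq_single e]
          · rw [Pi.single_eq_same]
          · intro a _ ha; rw [Pi.single_eq_of_ne ha.symm, ite_self]
          · exact fun h => absurd he h
        rw [Pi.sub_apply, Pi.smul_apply, h1, h1 (fun e => e.1 = v) fun _ => q]
        convert sosCone_zero_mem using 1
        simp only [Pi.single_apply]
        split_ifs <;> simp
    have h2 := hg _ hy
    simpa [pushforward, LinearMap.sum_apply] using h2
  · intro e he q hq
    refine hg _ (mem_primalCone.mpr ⟨0, fun v => sosCone_zero_mem, fun f _ => ?_⟩)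
    rcases eq_or_ne f e with rfl | hf
    · simpa using hq
    · simpa [Pi.single_eq_of_ne hf] using sosCone_zero_mem
  · rw [← hunit, arcUnit, map_sum]
    rfl

/-! ### Norms of products -/

theorem euclNorm_nonneg (M : Matrix (Fin n) (Fin n) ℝ) : 0 ≤ euclNorm M := norm_nonneg _

theorem euclNorm_mul_le (M N : Matrix (Fin n) (Fin n) ℝ) :
    euclNorm (M * N) ≤ euclNorm M * euclNorm N := by
  rw [euclNorm, map_mul]
  exact norm_mul_le _ _

theorem euclNorm_one_le : euclNorm (1 : Matrix (Fin n) (Fin n) ℝ) ≤ 1 := by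
  rw [euclNorm, map_one]
  exact ContinuousLinearMap.norm_id_le

theorem prodMat_append (A : Fin m → Matrix (Fin n) (Fin n) ℝ) (s t : List (Fin m)) :
    prodMat A (s ++ t) = prodMat A t * prodMat A s := by
  induction s with
  | nil => simp [prodMat]
  | cons a s ih => rw [List.cons_append, prodMat, prodMat, ih, mul_assoc]

/-- This keeps all the root sequences bounded, without which real `liminf` and `limsup` carry no
information. -/
theorem exists_norm_bound (A : Fin m → Matrix (Fin n) (Fin n) ℝ) :
    ∃ B : ℝ, 1 ≤ B ∧ ∀ t, euclNorm (prodMat A t) ≤ B ^ t.length := by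
  refine ⟨1 + ∑ σ, euclNorm (A σ),
    le_add_of_nonneg_right (Finset.sum_nonneg fun σ _ => euclNorm_nonneg _), fun t => ?_⟩
  induction t with
  | nil => simpa [prodMat] using euclNorm_one_le
  | cons σ t ih =>
    have h : euclNorm (A σ) ≤ 1 + ∑ σ, euclNorm (A σ) :=
      (Finset.single_le_sum (fun σ _ => euclNorm_nonneg (A σ)) (Finset.mem_univ σ)).trans
        (le_add_of_nonneg_left zero_le_one)
    rw [prodMat, List.length_cons, pow_succ]
    exact (euclNorm_mul_le _ _).trans
      (mul_le_mul ih h (euclNorm_nonneg _) ((euclNorm_nonneg _).trans ih))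

theorem root_le_of_le_pow {a B : ℝ} (ha : 0 ≤ a) (hB : 1 ≤ B) {k : ℕ} (h : a ≤ B ^ k) :
    a ^ (1 / (k : ℝ)) ≤ B := by
  rcases Nat.eq_zero_or_pos k with rfl | hk
  · simpa using hB
  · calc a ^ (1 / (k : ℝ)) ≤ (B ^ k) ^ (1 / (k : ℝ)) :=
          Real.rpow_le_rpow ha h (by positivity)
      _ = B := by rw [one_div, Real.pow_rpow_inv_natCast (by linarith) hk.ne']

theorem le_liminf_root {a : ℕ → ℝ} {c θ B : ℝ} (hc : 0 < c) (hθ : 0 < θ)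
    (h : ∀ k, c * θ ^ k ≤ a k) (hB : ∀ k, a k ^ (1 / (k : ℝ)) ≤ B) :
    θ ≤ Filter.liminf (fun k : ℕ => a k ^ (1 / (k : ℝ))) Filter.atTop := by
  have h1 : Filter.Tendsto (fun k : ℕ => c ^ (1 / (k : ℝ)) * θ) Filter.atTop (nhds θ) := by
    have h2 : Filter.Tendsto (fun k : ℕ => c ^ (1 / (k : ℝ))) Filter.atTop (nhds (c ^ (0 : ℝ))) :=
      tendsto_const_nhds.rpow tendsto_one_div_atTop_nhds_zero_nat (Or.inl hc.ne')
    simpa using h2.mul_const θ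
  rw [← h1.liminf_eq]
  refine Filter.liminf_le_liminf ?_ h1.isBoundedUnder_ge
    (Filter.isBoundedUnder_of ⟨B, hB⟩).isCoboundedUnder_ge
  filter_upwards [Filter.eventually_gt_atTop 0] with k hk
  calc c ^ (1 / (k : ℝ)) * θ = (c * θ ^ k) ^ (1 / (k : ℝ)) := by
        rw [Real.mul_rpow hc.le (by positivity), one_div,
          Real.pow_rpow_inv_natCast hθ.le hk.ne']
    _ ≤ a k ^ (1 / (k : ℝ)) := Real.rpow_le_rpow (by positivity) (h k) (by positivity)

/-! ### Paths -/

theorem Automaton.IsPath.append {G : Automaton V m} {u v w : V} {s t : List (V × V × Fin m)}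
    (hs : G.IsPath u v s) (ht : G.IsPath v w t) : G.IsPath u w (s ++ t) := by
  induction s generalizing u with
  | nil => rw [show u = v from hs]; exact ht
  | cons e s ih => exact ⟨hs.1, hs.2.1, ih hs.2.2⟩

theorem Automaton.isPath_singleton {G : Automaton V m} {e : V × V × Fin m} (he : e ∈ G.arcs) :
    G.IsPath e.1 e.2.1 [e] := ⟨he, rfl, rfl⟩

theorem Automaton.IsPath.exists_last {G : Automaton V m} {u v : V} {s : List (V × V × Fin m)}
    (hs : G.IsPath u v s) (hne : s ≠ []) : ∃ e ∈ G.arcs, e.2.1 = v := by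
  induction s generalizing u with
  | nil => exact absurd rfl hne
  | cons e s ih =>
    rcases s with _ | ⟨f, s⟩
    · exact ⟨e, hs.1, hs.2.2⟩
    · exact ih hs.2.2 (List.cons_ne_nil f s)

/-- Paths are prolonged at their start: any arc followed by a path to `u` ends with an arc entering
`u`. -/
theorem Automaton.StronglyConnected.exists_path {G : Automaton V m} (hG : G.StronglyConnected)
    (hne : G.arcs.Nonempty) (v : V) (l : ℕ) : ∃ u s, s.length = l ∧ G.IsPath u v s := by
  induction l with
  | zero => exact ⟨v, [], rfl, rfl⟩
  | succ l ih =>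
    obtain ⟨u, s, hs, hp⟩ := ih
    obtain ⟨e, he⟩ := hne
    obtain ⟨t, ht⟩ := hG e.2.1 u
    obtain ⟨f, hf, rfl⟩ :=
      ((Automaton.isPath_singleton he).append ht).exists_last (by simp)
    exact ⟨f.1, f :: s, by simp [hs], hf, rfl, hp⟩

theorem length_backPath (v : ℕ → V) (σ : ℕ → Fin m) (k i : ℕ) :
    (backPath v σ k i).length = i := by
  induction i with
  | zero => rfl
  | succ i ih => rw [backPath, List.length_cons, ih]

theorem revLabels_add (v : ℕ → V) (σ : ℕ → Fin m) (k i : ℕ) :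
    revLabels σ (k + i) = labels (backPath v σ k i) ++ revLabels σ k := by
  induction i with
  | zero => rfl
  | succ i ih => rw [← add_assoc, revLabels, ih]; rfl

theorem length_revLabels (σ : ℕ → Fin m) (k : ℕ) : (revLabels σ k).length = k := by
  induction k with
  | zero => rfl
  | succ k ih => rw [revLabels, List.length_cons, ih]

theorem arc_mem_of_isPath_backPath {G : Automaton V m} {v : ℕ → V} {σ : ℕ → Fin m} {k i : ℕ}
    {u w : V} (h : G.IsPath u w (backPath v σ k i)) {t : ℕ} (ht : t < i) :
    (v (k + t + 1), v (k + t), σ (k + t + 1)) ∈ G.arcs := by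
  induction i generalizing u with
  | zero => exact absurd ht (Nat.not_lt_zero t)
  | succ i ih =>
    rcases Nat.lt_succ_iff_lt_or_eq.mp ht with h' | rfl
    · exact ih h.2.2 h'
    · exact h.1

theorem isPath_backPath {G : Automaton V m} {v : ℕ → V} {σ : ℕ → Fin m}
    (h : ∀ k, (v (k + 1), v k, σ (k + 1)) ∈ G.arcs) (k i : ℕ) :
    G.IsPath (v (k + i)) (v k) (backPath v σ k i) := by
  induction i with
  | zero => rfl
  | succ i ih => exact ⟨h (k + i), rfl, ih⟩

theorem transposeAdmissible_of_arcs {G : Automaton V m} {v : ℕ → V} {σ : ℕ → Fin m}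
    (h : ∀ k, (v (k + 1), v k, σ (k + 1)) ∈ G.arcs) : G.TransposeAdmissible σ := by
  refine fun k _ => ⟨_, _, backPath v σ 0 k, isPath_backPath h 0 k, ?_⟩
  have := revLabels_add v σ 0 k
  rw [zero_add] at this
  rw [this, revLabels, List.append_nil]

/-- A path that is read off backwards from sequences of nodes and labels. -/
theorem backPath_eq {G : Automaton V m} {v : ℕ → V} {σ : ℕ → Fin m} {k i : ℕ}
    {s : List (V × V × Fin m)} {u : V} (e₀ : V × V × Fin m) (hs : G.IsPath u (v k) s)
    (hl : s.length = i) (hv : ∀ t < i, v (k + t + 1) = (s.getD (i - 1 - t) e₀).1)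
    (hσ : ∀ t < i, σ (k + t + 1) = (s.getD (i - 1 - t) e₀).2.2) :
    backPath v σ k i = s ∧ v (k + i) = u := by
  induction s generalizing u i with
  | nil => subst hl; exact ⟨rfl, hs.symm⟩
  | cons e s ih =>
    subst hl
    have hstep : ∀ t < s.length,
        (e :: s).getD (s.length + 1 - 1 - t) e₀ = s.getD (s.length - 1 - t) e₀ := by
      intro t ht
      have : s.length + 1 - 1 - t = (s.length - 1 - t) + 1 := by omega
      rw [this, List.getD_cons_succ]
    obtain ⟨h1, h2⟩ := ih hs.2.2 rfl
      (fun t ht => by rw [hv t (by simp; omega), List.length_cons, hstep t ht])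
      (fun t ht => by rw [hσ t (by simp; omega), List.length_cons, hstep t ht])
    have h3 := hv s.length (by simp)
    have h4 := hσ s.length (by simp)
    simp only [List.length_cons, Nat.add_sub_cancel, Nat.sub_self, List.getD_cons_zero] at h3 h4
    rw [List.length_cons, backPath, h1, h2, h3, h4]
    exact ⟨rfl, h3.trans hs.2.1⟩

/-! ### Growth of products -/

theorem euclNorm_le_growth (G : Automaton V m) (A : Fin m → Matrix (Fin n) (Fin n) ℝ)
    {t : List (Fin m)} (ht : G.Admissible t) :
    euclNorm (prodMat A t) ^ (1 / (t.length : ℝ)) ≤ growth G A t.length := by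
  obtain ⟨B, hB, h⟩ := exists_norm_bound A
  refine le_csSup ⟨B, ?_⟩ ⟨t, rfl, ht, rfl⟩
  rintro _ ⟨s, hs, -, rfl⟩
  exact root_le_of_le_pow (euclNorm_nonneg _) hB (hs ▸ h s)

theorem growth_le (G : Automaton V m) {A : Fin m → Matrix (Fin n) (Fin n) ℝ} {B : ℝ}
    (hB : 1 ≤ B) (h : ∀ t, euclNorm (prodMat A t) ≤ B ^ t.length) (k : ℕ) : growth G A k ≤ B := by
  refine Real.sSup_le ?_ (zero_le_one.trans hB)
  rintro _ ⟨s, hs, -, rfl⟩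
  exact root_le_of_le_pow (euclNorm_nonneg _) hB (hs ▸ h s)

theorem rootNorm_nonneg (A : Fin m → Matrix (Fin n) (Fin n) ℝ) (σ : ℕ → Fin m) (k : ℕ) :
    0 ≤ rootNorm A σ k := Real.rpow_nonneg (euclNorm_nonneg _) _

theorem rootNorm_le {A : Fin m → Matrix (Fin n) (Fin n) ℝ} {B : ℝ} (hB : 1 ≤ B)
    (h : ∀ t, euclNorm (prodMat A t) ≤ B ^ t.length) (σ : ℕ → Fin m) (k : ℕ) :
    rootNorm A σ k ≤ B := by
  refine root_le_of_le_pow (euclNorm_nonneg _) hB ?_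
  simpa only [length_revLabels] using h (revLabels σ k)

theorem limsup_rootNorm_le_cjsr {G : Automaton V m} (A : Fin m → Matrix (Fin n) (Fin n) ℝ)
    {σ : ℕ → Fin m} (hσ : G.TransposeAdmissible σ) :
    Filter.limsup (rootNorm A σ) Filter.atTop ≤ cjsr G A := by
  obtain ⟨B, hB, h⟩ := exists_norm_bound A
  refine Filter.limsup_le_limsup ?_
    (Filter.isBoundedUnder_of ⟨0, rootNorm_nonneg A σ⟩).isCoboundedUnder_le
    (Filter.isBoundedUnder_of ⟨B, growth_le G hB h⟩)
  filter_upwards [Filter.eventually_ge_atTop 1] with k hk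
  simpa only [length_revLabels, rootNorm] using euclNorm_le_growth G A (hσ k hk)

theorem liminf_rootNorm_le_limsup (A : Fin m → Matrix (Fin n) (Fin n) ℝ) (σ : ℕ → Fin m) :
    Filter.liminf (rootNorm A σ) Filter.atTop ≤ Filter.limsup (rootNorm A σ) Filter.atTop := by
  obtain ⟨B, hB, h⟩ := exists_norm_bound A
  exact Filter.liminf_le_limsup (Filter.isBoundedUnder_of ⟨B, rootNorm_le hB h σ⟩)
    (Filter.isBoundedUnder_of ⟨0, rootNorm_nonneg A σ⟩)

theorem liminf_rootNorm_nonneg (A : Fin m → Matrix (Fin n) (Fin n) ℝ) (σ : ℕ → Fin m) :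
    0 ≤ Filter.liminf (rootNorm A σ) Filter.atTop := by
  obtain ⟨B, hB, h⟩ := exists_norm_bound A
  exact Filter.le_liminf_of_le
    (Filter.isBoundedUnder_of ⟨B, rootNorm_le hB h σ⟩).isCoboundedUnder_ge
    (Filter.Eventually.of_forall (rootNorm_nonneg A σ))

/-- A geometric lower bound on the norms at the multiples of `l` bounds the rate of growth from
below. -/
theorem le_liminf_rootNorm (A : Fin m → Matrix (Fin n) (Fin n) ℝ) (v : ℕ → V) (σ : ℕ → Fin m)
    {l : ℕ} (hl : 0 < l) {c θ : ℝ} (hc : 0 < c) (hθ : 0 < θ)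
    (h : ∀ j, c * θ ^ (j * l) ≤ euclNorm (prodMat A (revLabels σ (j * l)))) :
    θ ≤ Filter.liminf (rootNorm A σ) Filter.atTop := by
  obtain ⟨B, hB, hA⟩ := exists_norm_bound A
  have hB0 : 0 < B := one_pos.trans_le hB
  have hm : 0 < min 1 θ := lt_min one_pos hθ
  -- The index `k` is compared with the next multiple `k + r` of `l`: the extra factors cost at most
  -- `B ^ l` in norm, and `θ ^ r` is at least `min 1 θ ^ l` whether or not `θ < 1`.
  refine le_liminf_root (c := c * min 1 θ ^ l / B ^ l) (B := B) (by positivity) hθ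
    (fun k => ?_) (rootNorm_le hB hA σ)
  obtain ⟨r, hr, j, hj⟩ : ∃ r ≤ l, ∃ j, j * l = k + r := by
    refine ⟨l - k % l, Nat.sub_le _ _, k / l + 1, ?_⟩
    have h1 := Nat.div_add_mod k l
    have h2 := Nat.mod_lt k hl
    rw [mul_comm] at h1
    rw [add_mul, one_mul]
    omega
  have h1 : euclNorm (prodMat A (revLabels σ (k + r))) ≤
      euclNorm (prodMat A (revLabels σ k)) * B ^ l := by
    rw [revLabels_add v, prodMat_append]
    refine (euclNorm_mul_le _ _).trans (mul_le_mul_of_nonneg_left ?_ (euclNorm_nonneg _))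
    refine (hA _).trans ?_
    rw [labels, List.length_map, length_backPath]
    exact pow_le_pow_right₀ hB hr
  have h2 : min 1 θ ^ l ≤ θ ^ r :=
    (pow_le_pow_of_le_one hm.le (min_le_left _ _) hr).trans
      (pow_le_pow_left₀ hm.le (min_le_right _ _) r)
  have h3 := h j
  rw [hj] at h3
  rw [div_mul_eq_mul_div, div_le_iff₀ (by positivity)]
  refine le_trans ?_ (h3.trans h1)
  rw [mul_assoc, pow_add, mul_comm (θ ^ k)]
  gcongr

/-! ### Counting paths -/

theorem adjMatrix_transpose_mulVec [Fintype V] [DecidableEq V] (G : Automaton V m) (w : V → ℝ)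
    (v : V) : (G.adjMatrixᵀ *ᵥ w) v = ∑ e ∈ G.arcs.filter (fun e => e.2.1 = v), w e.1 := by
  have h1 : ∑ e ∈ G.arcs.filter (fun e => e.2.1 = v), w e.1 =
      ∑ e : V × V × Fin m, if e.2.1 = v then (if e ∈ G.arcs then w e.1 else 0) else 0 := by
    rw [Finset.sum_filter, ← Finset.sum_filter_add_sum_filter_not Finset.univ (· ∈ G.arcs),
      Finset.filter_univ_mem, Finset.sum_eq_zero (s := Finset.univ.filter (· ∉ G.arcs)), add_zero]
    · exact Finset.sum_congr rfl fun e he => by rw [if_pos he]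
    · intro e he
      rw [if_neg (Finset.mem_filter.mp he).2, ite_self]
  rw [h1]
  simp only [Fintype.sum_prod_type, Matrix.mulVec, dotProduct, Matrix.transpose_apply,
    Automaton.adjMatrix, Matrix.of_apply]
  refine Finset.sum_congr rfl fun u _ => ?_
  rw [Finset.sum_comm]
  simp [← Finset.sum_filter]

theorem mulVec_one_le_inftyNorm [Fintype V] (M : Matrix V V ℝ) (v : V) :
    (M *ᵥ 1) v ≤ inftyNorm M := by
  open scoped Matrix.Norms.Operator in
  have : Nonempty V := ⟨v⟩
  calc (M *ᵥ 1) v ≤ ‖M *ᵥ (1 : V → ℝ)‖ := (Real.le_norm_self _).trans (norm_le_pi_norm _ v)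
    _ ≤ inftyNorm M * ‖(1 : V → ℝ)‖ := Matrix.linfty_opNorm_mulVec M 1
    _ = inftyNorm M := by rw [norm_one, mul_one]

theorem inftyNorm_nonneg [Fintype V] (M : Matrix V V ℝ) : 0 ≤ inftyNorm M := by
  open scoped Matrix.Norms.Operator in exact norm_nonneg M

/-! ### The flow inequality along paths -/

theorem DualFeasible.flow_le [DecidableEq V] {G : Automaton V m}
    {A : Fin m → Matrix (Fin n) (Fin n) ℝ} {γ : ℝ} {μ : V × V × Fin m → Module.Dual ℝ (HomPoly n d)}
    (hμ : DualFeasible G A d γ μ) {p : HomPoly n d} (hp : p ∈ sosCone n d) (v : V) :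
    γ ^ (2 * d) * ∑ e ∈ G.arcs.filter (fun e => e.1 = v), μ e p ≤
      ∑ e ∈ G.arcs.filter (fun e => e.2.1 = v), μ e (subst (A e.2.2) p) := by
  have := hμ.flow v p hp
  simpa [LinearMap.sum_apply, pushforward] using this

theorem score_append_singleton (A : Fin m → Matrix (Fin n) (Fin n) ℝ)
    (μ : V × V × Fin m → Module.Dual ℝ (HomPoly n d)) (p : HomPoly n d)
    {s : List (V × V × Fin m)} (hs : s ≠ []) (e : V × V × Fin m) :
    score A μ p (s ++ [e]) = score A μ (subst (A e.2.2) p) s := by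
  rcases s with _ | ⟨f, s⟩
  · exact absurd rfl hs
  · have h : prodMat A (labels (f :: (s ++ [e]))) = A e.2.2 * prodMat A (labels (f :: s)) := by
      rw [← List.cons_append, labels, List.map_append, prodMat_append]
      simp [prodMat, labels]
    rw [List.cons_append, score, score, subst_subst, h]

/-- Induction on the last arc `e` of the paths. The value of `μ e` is one nonnegative term of the
outflow at the source of `e`, to which the flow inequality applies again; multiplying by `A(G)ᵀ`
counts the choices of `e`. -/
theorem DualFeasible.flow_path_le [Fintype V] [DecidableEq V] {G : Automaton V m}
    {A : Fin m → Matrix (Fin n) (Fin n) ℝ} {γ : ℝ} {μ : V × V × Fin m → Module.Dual ℝ (HomPoly n d)}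
    (hμ : DualFeasible G A d γ μ) (l : ℕ) {p : HomPoly n d} (hp : p ∈ sosCone n d) (v : V) {B : ℝ}
    (hB : ∀ u s, s.length = l + 1 → G.IsPath u v s → score A μ p s ≤ B) :
    (γ ^ (2 * d)) ^ (l + 1) * ∑ e ∈ G.arcs.filter (fun e => e.1 = v), μ e p ≤
      B * ((G.adjMatrixᵀ ^ (l + 1)) *ᵥ 1) v := by
  have hγ : 0 ≤ γ ^ (2 * d) := by rw [pow_mul]; positivity
  induction l generalizing p v with
  | zero =>
    rw [zero_add, pow_one, pow_one, adjMatrix_transpose_mulVec, Finset.mul_sum _ _ B]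
    refine (hμ.flow_le hp v).trans (Finset.sum_le_sum fun e he => ?_)
    obtain ⟨hmem, rfl⟩ := Finset.mem_filter.mp he
    have := hB e.1 [e] rfl (Automaton.isPath_singleton hmem)
    simpa [score, labels, prodMat] using this
  | succ l ih =>
    rw [pow_succ (γ ^ (2 * d)), pow_succ' (G.adjMatrixᵀ), ← Matrix.mulVec_mulVec,
      adjMatrix_transpose_mulVec, Finset.mul_sum _ _ B, mul_assoc]
    refine (mul_le_mul_of_nonneg_left (hμ.flow_le hp v) (pow_nonneg hγ _)).trans ?_
    rw [Finset.mul_sum]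
    refine Finset.sum_le_sum fun e he => ?_
    obtain ⟨hmem, rfl⟩ := Finset.mem_filter.mp he
    have hq := subst_mem_sosCone (A e.2.2) hp
    refine le_trans (mul_le_mul_of_nonneg_left ?_ (pow_nonneg hγ _)) (ih hq e.1 ?_)
    · refine Finset.single_le_sum (f := fun f => μ f (subst (A e.2.2) p)) (fun f hf => ?_)
        (Finset.mem_filter.mpr ⟨hmem, rfl⟩)
      exact hμ.arc_dual f (Finset.mem_filter.mp hf).1 _ hq
    · intro u s hs hpath
      rw [← score_append_singleton A μ p (by rintro rfl; simp at hs) e]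
      exact hB u _ (by simp [hs]) (hpath.append (Automaton.isPath_singleton hmem))

theorem DualFeasible.apply_normPow_le_one [DecidableEq V] {G : Automaton V m}
    {A : Fin m → Matrix (Fin n) (Fin n) ℝ} {γ : ℝ} {μ : V × V × Fin m → Module.Dual ℝ (HomPoly n d)}
    (hμ : DualFeasible G A d γ μ) {e : V × V × Fin m} (he : e ∈ G.arcs) :
    μ e (normPow n d) ≤ 1 := by
  rw [← hμ.normalized]
  exact Finset.single_le_sum (f := fun e => μ e (normPow n d))
    (fun f hf => hμ.arc_dual f hf _ normPow_mem_sosCone) he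

/-- Two dominations are chained, `p` by `c ‖x‖ ^ (2 * d)` and `‖M x‖ ^ (2 * d)` by `(n ‖M‖) ^ (2 *
d) ‖x‖ ^ (2 * d)`, and each arc carries mass at most 1. The added `1` keeps `C` positive when `n =
0`. -/
theorem DualFeasible.exists_apply_subst_le [DecidableEq V] {G : Automaton V m}
    {A : Fin m → Matrix (Fin n) (Fin n) ℝ} {γ : ℝ} {μ : V × V × Fin m → Module.Dual ℝ (HomPoly n d)}
    (hμ : DualFeasible G A d γ μ) (p : HomPoly n d) :
    ∃ C : ℝ, 0 < C ∧ ∀ e ∈ G.arcs, ∀ M, μ e (subst M p) ≤ C * euclNorm M ^ (2 * d) := by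
  obtain ⟨c, hc, hcp⟩ := exists_smul_normPow_sub_mem p
  refine ⟨c * n ^ (2 * d) + 1, by positivity, fun e he M => ?_⟩
  have h1 : μ e (subst M p) ≤ c * μ e (subst M (normPow n d)) := by
    have := subst_mem_sosCone M hcp
    rw [map_sub, map_smul] at this
    simpa using sosDual_le (hμ.arc_dual e he) this
  have h2 : μ e (subst M (normPow n d)) ≤ (n * euclNorm M) ^ (2 * d) * μ e (normPow n d) := by
    simpa using sosDual_le (hμ.arc_dual e he) (smul_normPow_sub_subst_mem M)
  have hM : 0 ≤ euclNorm M := euclNorm_nonneg M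
  have h3 : (n * euclNorm M) ^ (2 * d) * μ e (normPow n d) ≤ (n * euclNorm M) ^ (2 * d) :=
    mul_le_of_le_one_right (by positivity) (hμ.apply_normPow_le_one he)
  calc μ e (subst M p) ≤ c * (n * euclNorm M) ^ (2 * d) :=
        h1.trans (mul_le_mul_of_nonneg_left (h2.trans h3) hc.le)
    _ = c * n ^ (2 * d) * euclNorm M ^ (2 * d) := by rw [mul_pow, mul_assoc]
    _ ≤ (c * n ^ (2 * d) + 1) * euclNorm M ^ (2 * d) := by
        gcongr
        linarith

/-! ### Runs of the algorithm -/

theorem IsRun.arc_mem {G : Automaton V m} {A : Fin m → Matrix (Fin n) (Fin n) ℝ} {l : ℕ}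
    (hl : 0 < l) {μ : V × V × Fin m → Module.Dual ℝ (HomPoly n d)} {r : Run V m n d}
    (hr : IsRun G A l μ r) (k : ℕ) : (r.node (k + 1), r.node k, r.label (k + 1)) ∈ G.arcs := by
  have := arc_mem_of_isPath_backPath (hr.is_path (k / l)) (Nat.mod_lt k hl)
  rwa [mul_comm, Nat.div_add_mod] at this

theorem IsRun.poly_mem {G : Automaton V m} {A : Fin m → Matrix (Fin n) (Fin n) ℝ} {l : ℕ}
    {μ : V × V × Fin m → Module.Dual ℝ (HomPoly n d)} {r : Run V m n d}
    (hr : IsRun G A l μ r) (j : ℕ) : r.poly j ∈ sosCone n d := by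
  induction j with
  | zero => exact sosInterior_subset hr.init_poly
  | succ j ih => rw [hr.poly_succ]; exact subst_mem_sosCone _ ih

theorem IsRun.poly_eq {G : Automaton V m} {A : Fin m → Matrix (Fin n) (Fin n) ℝ} {l : ℕ}
    {μ : V × V × Fin m → Module.Dual ℝ (HomPoly n d)} {r : Run V m n d}
    (hr : IsRun G A l μ r) (j : ℕ) :
    r.poly j = subst (prodMat A (revLabels r.label (j * l))) (r.poly 0) := by
  induction j with
  | zero => rw [zero_mul, revLabels, prodMat, subst_one]
  | succ j ih =>
    rw [hr.poly_succ, Nat.succ_mul j l, revLabels_add r.node, prodMat_append, ← subst_subst, ← ih]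

/-- The arcs by which a run leaves the nodes `v_0, v_l, v_{2l}, …`. -/
def Run.outArc (r : Run V m n d) (l : ℕ) : ℕ → V × V × Fin m
  | 0 => (r.node 0, r.prev, r.label 0)
  | j + 1 => (r.node (j * l + l), r.node (j * l + (l - 1)), r.label (j * l + l))

theorem Run.outArc_fst (r : Run V m n d) (l j : ℕ) : (r.outArc l j).1 = r.node (j * l) := by
  cases j with
  | zero => rw [zero_mul]; rfl
  | succ j => rw [Nat.succ_mul]; rfl

theorem IsRun.outArc_mem {G : Automaton V m} {A : Fin m → Matrix (Fin n) (Fin n) ℝ} {l : ℕ}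
    (hl : 0 < l) {μ : V × V × Fin m → Module.Dual ℝ (HomPoly n d)} {r : Run V m n d}
    (hr : IsRun G A l μ r) (j : ℕ) : r.outArc l j ∈ G.arcs := by
  obtain ⟨l, rfl⟩ := Nat.exists_eq_succ_of_ne_zero hl.ne'
  cases j with
  | zero => exact hr.init_arc
  | succ j => exact hr.arc_mem hl (j * (l + 1) + l)

theorem IsRun.score_eq {G : Automaton V m} {A : Fin m → Matrix (Fin n) (Fin n) ℝ} {l : ℕ}
    (hl : 0 < l) {μ : V × V × Fin m → Module.Dual ℝ (HomPoly n d)} {r : Run V m n d}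
    (hr : IsRun G A l μ r) (j : ℕ) :
    score A μ (r.poly j) (backPath r.node r.label (j * l) l) =
      μ (r.outArc l (j + 1)) (r.poly (j + 1)) := by
  -- For `l` a successor, the head of `backPath` is by definition the arc leaving the next block's
  -- end node.
  obtain ⟨l, rfl⟩ := Nat.exists_eq_succ_of_ne_zero hl.ne'
  rw [hr.poly_succ]
  rfl

theorem IsRun.step_le [Fintype V] [DecidableEq V] {G : Automaton V m}
    {A : Fin m → Matrix (Fin n) (Fin n) ℝ} {l : ℕ} (hl : 0 < l) {γ : ℝ}
    {μ : V × V × Fin m → Module.Dual ℝ (HomPoly n d)} (hμ : DualFeasible G A d γ μ)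
    {r : Run V m n d} (hr : IsRun G A l μ r) (j : ℕ) :
    (γ ^ (2 * d)) ^ l * μ (r.outArc l j) (r.poly j) ≤
      μ (r.outArc l (j + 1)) (r.poly (j + 1)) * inftyNorm (G.adjMatrixᵀ ^ l) := by
  have hγ : 0 ≤ γ ^ (2 * d) := by rw [pow_mul]; positivity
  have h1 := hμ.flow_path_le (l - 1) (hr.poly_mem j) (r.node (j * l))
    (B := μ (r.outArc l (j + 1)) (r.poly (j + 1))) (fun u s hs hp => by
      rw [← hr.score_eq hl]
      exact hr.is_max j u s (by omega) hp)
  rw [Nat.sub_add_cancel hl] at h1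
  -- Replacing the path count by the norm uses that the maximal score is nonnegative; on the left,
  -- only the run's own arc is kept from the outflow.
  refine le_trans (mul_le_mul_of_nonneg_left ?_ (pow_nonneg hγ l)) (h1.trans
    (mul_le_mul_of_nonneg_left (mulVec_one_le_inftyNorm _ _)
      (hμ.arc_dual _ (hr.outArc_mem hl _) _ (hr.poly_mem _))))
  exact Finset.single_le_sum (f := fun e => μ e (r.poly j))
    (fun e he => hμ.arc_dual e (Finset.mem_filter.mp he).1 _ (hr.poly_mem j))
    (Finset.mem_filter.mpr ⟨hr.outArc_mem hl j, r.outArc_fst l j⟩)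

theorem IsRun.le_liminf [Fintype V] [DecidableEq V] {G : Automaton V m}
    {A : Fin m → Matrix (Fin n) (Fin n) ℝ} {l : ℕ} (hd : 0 < d) (hl : 0 < l) {γ : ℝ}
    {μ : V × V × Fin m → Module.Dual ℝ (HomPoly n d)} (hμ : DualFeasible G A d γ μ)
    {r : Run V m n d} (hr : IsRun G A l μ r) :
    γ / inftyNorm (G.adjMatrixᵀ ^ l) ^ (1 / (2 * (d : ℝ) * (l : ℝ))) ≤
      Filter.liminf (rootNorm A r.label) Filter.atTop := by
  set N := inftyNorm (G.adjMatrixᵀ ^ l) with hN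
  have hN0 : 0 ≤ N := inftyNorm_nonneg _
  set θ := γ / N ^ (1 / (2 * (d : ℝ) * (l : ℝ))) with hθdef
  -- The trivial case also covers `N = 0`, where division by zero makes `θ` vanish.
  rcases le_or_gt θ 0 with hθ | hθ
  · exact hθ.trans (liminf_rootNorm_nonneg A r.label)
  have hNpos : 0 < N := by
    refine hN0.lt_of_ne fun h0 => ?_
    rw [hθdef, ← h0, Real.zero_rpow (by positivity), div_zero] at hθ
    exact lt_irrefl _ hθ
  have hθpow : (θ ^ l) ^ (2 * d) * N = (γ ^ (2 * d)) ^ l := by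
    have h1 : (N ^ (1 / (2 * (d : ℝ) * (l : ℝ)))) ^ (2 * d * l) = N := by
      have : (2 * (d : ℝ) * (l : ℝ)) = ((2 * d * l : ℕ) : ℝ) := by push_cast; ring
      rw [this, one_div, Real.rpow_inv_natCast_pow hN0 (by positivity)]
    have h2 : (θ ^ l) ^ (2 * d) = γ ^ (2 * d * l) / N := by
      rw [← pow_mul, mul_comm l, hθdef, div_pow, h1]
    rw [h2, ← pow_mul, div_mul_cancel₀ _ hNpos.ne']
  set D : ℕ → ℝ := fun j => μ (r.outArc l j) (r.poly j) with hD
  have hD0 : 0 < D 0 := hr.init_pos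
  have hDj : ∀ j, D 0 * ((θ ^ l) ^ (2 * d)) ^ j ≤ D j := by
    intro j
    induction j with
    | zero => simp
    | succ j ih =>
      have h1 := hr.step_le hl hμ j
      rw [← hN, ← hθpow, mul_right_comm] at h1
      have h2 := le_of_mul_le_mul_right h1 hNpos
      rw [pow_succ, ← mul_assoc, mul_comm _ ((θ ^ l) ^ (2 * d))]
      exact (mul_le_mul_of_nonneg_left ih (by positivity)).trans h2
  obtain ⟨C, hC, hCM⟩ := hμ.exists_apply_subst_le (r.poly 0)
  -- Capping at 1 makes the `2 * d`-th power of the constant at most `D 0 / C`, so no root of it has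
  -- to be taken.
  have hc : 0 < min 1 (D 0 / C) := lt_min one_pos (div_pos hD0 hC)
  refine le_liminf_rootNorm A r.node r.label hl hc hθ fun j => ?_
  refine le_of_pow_le_pow_left₀ (n := 2 * d) (by omega) (euclNorm_nonneg _) ?_
  have h1 : D 0 * ((θ ^ l) ^ (2 * d)) ^ j ≤
      C * euclNorm (prodMat A (revLabels r.label (j * l))) ^ (2 * d) := by
    refine (hDj j).trans ?_
    rw [hD]
    dsimp only
    rw [hr.poly_eq j]
    exact hCM _ (hr.outArc_mem hl j) _
  have h2 : min 1 (D 0 / C) ^ (2 * d) ≤ D 0 / C :=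
    (pow_le_of_le_one hc.le (min_le_left _ _) (by omega)).trans (min_le_right _ _)
  calc (min 1 (D 0 / C) * θ ^ (j * l)) ^ (2 * d)
      = min 1 (D 0 / C) ^ (2 * d) * ((θ ^ l) ^ (2 * d)) ^ j := by
        rw [mul_pow, ← pow_mul, ← pow_mul, ← pow_mul]
        congr 2
        ring
    _ ≤ D 0 / C * ((θ ^ l) ^ (2 * d)) ^ j := mul_le_mul_of_nonneg_right h2 (by positivity)
    _ ≤ euclNorm (prodMat A (revLabels r.label (j * l))) ^ (2 * d) := by
        rw [div_mul_eq_mul_div, div_le_iff₀ hC, mul_comm _ C]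
        exact h1

theorem exists_max_score [Fintype V] {G : Automaton V m} (hG : G.StronglyConnected)
    (hne : G.arcs.Nonempty) (A : Fin m → Matrix (Fin n) (Fin n) ℝ) (l : ℕ)
    (μ : V × V × Fin m → Module.Dual ℝ (HomPoly n d)) (v : V) (p : HomPoly n d) :
    ∃ u s, s.length = l ∧ G.IsPath u v s ∧
      ∀ u' s', s'.length = l → G.IsPath u' v s' → score A μ p s' ≤ score A μ p s := by
  obtain ⟨u, s, hs, hp⟩ := hG.exists_path hne v l
  obtain ⟨s, ⟨hs, u, hp⟩, hmax⟩ := Set.exists_max_image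
    {s : List (V × V × Fin m) | s.length = l ∧ ∃ u, G.IsPath u v s} (score A μ p)
    ((List.finite_length_eq (V × V × Fin m) l).subset fun s hs => hs.1) ⟨s, hs, u, hp⟩
  exact ⟨u, s, hs, hp, fun u' s' hs' hp' => hmax s' ⟨hs', u', hp'⟩⟩

theorem DualFeasible.exists_isRun [Fintype V] [DecidableEq V] {G : Automaton V m}
    (hG : G.StronglyConnected) {A : Fin m → Matrix (Fin n) (Fin n) ℝ} {l : ℕ} (hl : 0 < l) {γ : ℝ}
    {μ : V × V × Fin m → Module.Dual ℝ (HomPoly n d)} (hμ : DualFeasible G A d γ μ) :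
    ∃ r, IsRun G A l μ r := by
  obtain ⟨e₀, he₀, hpos⟩ : ∃ e ∈ G.arcs, 0 < μ e (normPow n d) := by
    refine Finset.exists_lt_of_sum_lt (f := fun _ => (0 : ℝ)) ?_
    rw [Finset.sum_const_zero, hμ.normalized]
    exact one_pos
  choose start pick hlen hpath hmax using exists_max_score hG ⟨e₀, he₀⟩ A l μ
  let state : ℕ → V × HomPoly n d := fun j => Nat.rec (e₀.1, normPow n d)
    (fun _ x => (start x.1 x.2, subst (prodMat A (labels (pick x.1 x.2))) x.2)) j
  let path : ℕ → List (V × V × Fin m) := fun j => pick (state j).1 (state j).2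
  -- Time runs against the arcs, so each chosen path is read from its end; the index is below `l`,
  -- and the default `e₀` is never used.
  let arc : ℕ → V × V × Fin m := fun k => (path (k / l)).getD (l - 1 - k % l) e₀
  let node : ℕ → V := fun k => Nat.casesOn k e₀.1 fun k => (arc k).1
  let label : ℕ → Fin m := fun k => Nat.casesOn k e₀.2.2 fun k => (arc k).2.2
  have harc : ∀ j, ∀ t < l, arc (j * l + t) = (path j).getD (l - 1 - t) e₀ := by
    intro j t ht
    have h1 : (j * l + t) / l = j := by
      rw [mul_comm, Nat.mul_add_div hl, Nat.div_eq_of_lt ht, add_zero]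
    have h2 : (j * l + t) % l = t := by rw [mul_comm, Nat.mul_add_mod, Nat.mod_eq_of_lt ht]
    change (path ((j * l + t) / l)).getD (l - 1 - (j * l + t) % l) e₀ = _
    rw [h1, h2]
  have hback : ∀ j, node (j * l) = (state j).1 → backPath node label (j * l) l = path j ∧
      node (j * l + l) = (state (j + 1)).1 := by
    intro j hj
    refine backPath_eq (G := G) e₀ ?_ (hlen _ _)
      (fun t ht => congrArg (fun e => e.1) (harc j t ht))
      (fun t ht => congrArg (fun e => e.2.2) (harc j t ht))
    rw [hj]
    exact hpath _ _
  have hnode : ∀ j, node (j * l) = (state j).1 := by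
    intro j
    induction j with
    | zero => rw [zero_mul]; rfl
    | succ j ih => rw [Nat.succ_mul]; exact (hback j ih).2
  refine ⟨⟨node, e₀.2.1, label, fun j => (state j).2⟩,
    normPow_mem_sosInterior, he₀, hpos, fun j => ?_, fun j u s hs hp => ?_, fun j => ?_⟩
  · dsimp only
    rw [(hback j (hnode j)).1, (hback j (hnode j)).2, hnode j]
    exact hpath _ _
  · dsimp only at hp ⊢
    rw [(hback j (hnode j)).1]
    rw [hnode j] at hp
    exact hmax _ _ u s hs hp
  · dsimp only
    rw [(hback j (hnode j)).1]

end SwitchedSystem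

end

theorem mainTheorem2 {V : Type*} [Fintype V] [DecidableEq V] {m n : ℕ}
    (G : SwitchedSystem.Automaton V m) (hG : G.StronglyConnected)
    (A : Fin m → Matrix (Fin n) (Fin n) ℝ)
    (d l : ℕ) (hd : 0 < d) (hl : 0 < l)
    (γ : ℝ) (hγ : γ < SwitchedSystem.jsrSos G A d) :
    (0 ≤ γ → ∃ μ, SwitchedSystem.DualFeasible G A d γ μ) ∧
    ∀ μ, SwitchedSystem.DualFeasible G A d γ μ →
      (∃ r, SwitchedSystem.IsRun G A l μ r) ∧
      ∀ r, SwitchedSystem.IsRun G A l μ r →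
        (∀ k, (r.node k, r.node (k + 1), r.label (k + 1)) ∈ G.transpose.arcs) ∧
        G.TransposeAdmissible r.label ∧
        γ / SwitchedSystem.inftyNorm (G.adjMatrixᵀ ^ l) ^ (1 / (2 * (d : ℝ) * (l : ℝ))) ≤
          Filter.liminf (SwitchedSystem.rootNorm A r.label) Filter.atTop ∧
        Filter.limsup (SwitchedSystem.rootNorm A r.label) Filter.atTop ≤
          SwitchedSystem.cjsr G A ∧
        γ / SwitchedSystem.inftyNorm (G.adjMatrixᵀ ^ l) ^ (1 / (2 * (d : ℝ) * (l : ℝ))) ≤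
          SwitchedSystem.cjsr G A := by
  refine ⟨fun hγ0 => SwitchedSystem.exists_dualFeasible G A hγ0 hγ, fun μ hμ =>
    ⟨hμ.exists_isRun hG hl, fun r hr => ?_⟩⟩
  have hadm : G.TransposeAdmissible r.label :=
    SwitchedSystem.transposeAdmissible_of_arcs (hr.arc_mem hl)
  have hlow := hr.le_liminf hd hl hμ
  have hup := SwitchedSystem.limsup_rootNorm_le_cjsr A hadm
  refine ⟨fun k => ?_, hadm, hlow, hup, hlow.trans
    ((SwitchedSystem.liminf_rootNorm_le_limsup A r.label).trans hup)⟩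
  exact Finset.mem_image.mpr ⟨_, hr.arc_mem hl k, rfl⟩
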